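/- **Setting.** Let $d\ge 2$ and $n\ge 1$ be integers, $\sigma>0$, and $\mu\in\mathbb R^d$ a unit vector. Let $\mathcal D_{\mu,\sigma,d}$ be the law of $(x,y)$, where $x=z+\xi$, $z$ is uniform on $\{\mu,-\mu\}$, $\xi$ is independent of $z$ and uniform on the sphere of radius $\sqrt{d-1}\,\sigma$ centred at the origin in the $(d-1)$-dimensional subspace orthogonal to $\mu$, and $y=\mu^{T}x\in\{1,-1\}$. Put $\Omega_{\sigma,d}=\{\mathcal D_{\mu,\sigma,d}:\|\mu\|_2=1\}$ and $\kappa=\frac{n}{d\sigma^2}$. For $w\in\mathbb R^d$ let $f_w(x)=w^{T}x$, and let $\mathcal L_{\mathcal D}(f_w)=\Pr_{(x,y)\sim\mathcal D}[\operatorname{sign}(f_w(x))\ne \operatorname{sign}(y)]$ be its test loss. For a sample $S=((x_i,y_i))_{i=1}^n$ let $\gamma(f_w,S)=\min_i y_i f_w(x_i)$ and $\gamma^*(S)=\sup_{\|w\|_2\le 1}\gamma(f_w,S)$. A nonzero vector $w$ is a $(1-\epsilon)$-max-margin solution for $S$ if $\gamma(f_w,S)/\|w\|_2\ge(1-\epsilon)\gamma^*(S)$.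 **Theorem.** (i) For every $\delta>0$ there are constants $\epsilon=\epsilon(\delta)>0$ and $c=c(\delta)>0$ such that for all $n,d,\sigma$ and all $\mathcal D\in\Omega_{\sigma,d}$ with $\delta\le\kappa\le\frac1\delta$ and $\frac dn\ge c$, with probability at least $1-3e^{-n}$ over $S\sim\mathcal D^n$, every $w\in\mathbb R^d$ that is a $(1-\epsilon)$-max-margin solution for $S$ satisfies $$\mathcal L_{\mathcal D}(f_w)\le e^{-\frac{n}{36d\sigma^4}}+e^{-n/8}.$$ (ii) There is a universal constant $c>0$ such that for all $n,d,\sigma$ and all $\mathcal D\in\Omega_{\sigma,d}$ with $\kappa>0$ and $\frac dn\ge c\max\left(\frac1{\kappa^2},\kappa^2\right)$, with probability at least $1-3e^{-n}$ over $S\sim\mathcal D^n$, every $w\in\mathbb R^d$ that is a $(1-\epsilon)$-max-margin solution for $S$ with $\epsilon=\frac1c\min\left(\frac1\kappa,\kappa\right)$ satisfies the same bound. -/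

import Mathlib

open MeasureTheory Set
open scoped ENNReal InnerProductSpace

noncomputable section

namespace ExtremalMargin

/-- The feature space `ℝ^d` with its Euclidean norm. -/
abbrev Feature (d : ℕ) : Type := EuclideanSpace ℝ (Fin d)

/-- A labelled example `(x, y)`; under the data distribution the label is `1` or `-1`. -/
abbrev Example (d : ℕ) : Type := Feature d × ℝ

/-- A training set of `n` labelled examples. -/
abbrev Sample (d n : ℕ) : Type := Fin n → Example d

/-- The uniform probability measure on the unit sphere of a finite-dimensional Euclidean space of
positive dimension: the surface measure divided by its total mass. -/
def uniformUnitSphere (V : Type*) [NormedAddCommGroup V] [InnerProductSpace ℝ V]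
    [FiniteDimensional ℝ V] [MeasurableSpace V] [BorelSpace V] :
    Measure (Metric.sphere (0 : V) 1) :=
  ((volume : Measure V).toSphere univ)⁻¹ • (volume : Measure V).toSphere

/-- The law of the noise `ξ`: uniform on the sphere of radius `√(d - 1) σ` of the
`(d - 1)`-dimensional subspace orthogonal to the direction `μ`. -/
def noiseLaw {d : ℕ} (μ : Feature d) (σ : ℝ) : Measure (Feature d) :=
  (uniformUnitSphere (ℝ ∙ μ)ᗮ).map
    (fun u : Metric.sphere (0 : (ℝ ∙ μ)ᗮ) 1 =>
      (Real.sqrt ((d : ℝ) - 1) * σ) • ((u : (ℝ ∙ μ)ᗮ) : Feature d))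

/-- The law of the signal `z`: uniform on `{μ, -μ}`. -/
def signalLaw {d : ℕ} (μ : Feature d) : Measure (Feature d) :=
  (2⁻¹ : ℝ≥0∞) • (Measure.dirac μ + Measure.dirac (-μ))

/-- The law of `(x, y)`, where `x = z + ξ` with `z` and `ξ` independent, and `y = ⟪μ, x⟫`. -/
def linearDist {d : ℕ} (μ : Feature d) (σ : ℝ) : Measure (Example d) :=
  ((signalLaw μ).prod (noiseLaw μ σ)).map (fun p => (p.1 + p.2, ⟪μ, p.1 + p.2⟫_ℝ))

/-- The linear problem class: all the distributions above with `μ` a unit vector. -/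
def linearClass (σ : ℝ) (d : ℕ) : Set (Measure (Example d)) :=
  {D | ∃ μ : Feature d, ‖μ‖ = 1 ∧ D = linearDist μ σ}

/-- The law of a training set of `n` independent examples drawn from `D`. -/
def sampleLaw {d : ℕ} (D : Measure (Example d)) (n : ℕ) : Measure (Sample d n) :=
  Measure.pi (fun _ => D)

/-- The linear model `f_w(x) = wᵀ x`. -/
def linearModel {d : ℕ} (w : Feature d) : Feature d → ℝ := fun x => ⟪w, x⟫_ℝ

/-- The `0/1` loss: `1` if the signs of the two arguments disagree and `0` otherwise. -/
def zeroOneLoss (a b : ℝ) : ℝ := if SignType.sign a ≠ SignType.sign b then 1 else 0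

/-- The test loss of `h` on `D`: the expected `0/1` loss. -/
def testLoss {d : ℕ} (D : Measure (Example d)) (h : Feature d → ℝ) : ℝ :=
  ∫ p, zeroOneLoss (h p.1) p.2 ∂D

/-- The margin `min_i y_i h(x_i)` of `h` on a (nonempty) training set. -/
def margin {d n : ℕ} (h : Feature d → ℝ) (S : Sample d n) : ℝ := ⨅ i, (S i).2 * h (S i).1

/-- The maximum margin over linear models with `‖w‖ ≤ 1`. -/
def maxMargin {d n : ℕ} (S : Sample d n) : ℝ :=
  sSup ((fun w : Feature d => margin (linearModel w) S) '' Metric.closedBall 0 1)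

/-- `w` is a `(1 - ε)`-max-margin solution for `S`: its normalized margin is at least `1 - ε` times
the maximum margin. -/
def IsNearMaxMargin {d n : ℕ} (ε : ℝ) (S : Sample d n) (w : Feature d) : Prop :=
  w ≠ 0 ∧ (1 - ε) * maxMargin S ≤ margin (linearModel w) S / ‖w‖

/-- The signal-to-noise parameter `κ = n / (d σ²)`. -/
def snr (n d : ℕ) (σ : ℝ) : ℝ := (n : ℝ) / ((d : ℝ) * σ ^ 2)

/-- With probability at least `1 - 3 e^{-n}` over a training set of size `n` drawn from `D`, every
`(1 - ε)`-max-margin linear classifier has test loss at most `e^{-n/(36 d σ⁴)} + e^{-n/8}`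
(the exceptional set has outer measure at most `3 e^{-n}`). -/
def NearMaxMarginGeneralizes (n d : ℕ) (σ ε : ℝ) (D : Measure (Example d)) : Prop :=
  sampleLaw D n {S | ¬ ∀ w : Feature d, IsNearMaxMargin ε S w →
      testLoss D (linearModel w) ≤
        Real.exp (-((n : ℝ) / (36 * (d : ℝ) * σ ^ 4))) + Real.exp (-((n : ℝ) / 8))}
    ≤ ENNReal.ofReal (3 * Real.exp (-(n : ℝ)))

end ExtremalMargin

end

/-!
Write each example as `y • x = μ + R • h`, with `R = √(d - 1) σ` and `h` a uniform unit vector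
orthogonal to `μ`. Since `d` is much larger than `n`, the vectors `h` of a sample are almost
orthonormal. For exactly orthonormal ones, a vector `w = a • μ + v` with `v` orthogonal to `μ` has
margin at most `a + ‖v‖ / √k`, where `k = n / R ^ 2` is essentially the parameter `κ`, and the
maximum over unit vectors, `√(1 + 1 / k)`, is attained only at `a = √k * ‖v‖`. The maximum is
quadratic in the angle to this optimum, so a `(1 - ε)`-max-margin solution with `ε` of order
`min k (1 / k)` still has `a ≥ √k * ‖v‖ / 4`, and this survives errors of the same relative order
in the Gram matrix (`IsNearMaxMargin.signal_ge`). Since `⟪v, h⟫` is sub-Gaussian with variance proxy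
`‖v‖ ^ 2 / (d - 1)`, a Chernoff bound (`testLoss_linearModel_le`) turns this ratio into the claimed
test loss; the term `e^{-n/8}` is not needed.

Both probabilistic inputs come from one estimate: a uniform unit vector `u` in dimension `m`
satisfies `E exp ⟪a, u⟫ ≤ exp (‖a‖ ^ 2 / (2 m))` (`lintegral_exp_inner_uniformUnitSphere_le`). It is
proved by comparison with a Gaussian vector in polar coordinates, through Jensen's inequality for
the convex function `s ↦ cosh (√s x)` of the squared radius.

For the Gram matrix, fix coefficients `c` with `∑ c i ^ 2 = 1` and integrate out the vectors of
`‖∑ c i • h i‖ ^ 2` one at a time. Each step replaces the exponent `θ` by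
`θ (1 + 2 θ c i ^ 2 / m)` and contributes `exp (θ c i ^ 2)`, so the moment generating function obeys
a deterministic recursion (`lintegral_pi_exp_norm_sq_succ_le`), which gives both tails
(`measure_norm_sq_sum_deviation_le`). A union bound over a half-net of the sphere, of size at most
`5 ^ n`, extends this to all coefficients at once (`measure_not_almost_orthonormal_le`).

The statement with constants depending on `δ` follows from the one with explicit dependence on `κ`,
because near-max-margin solutions for a smaller `ε` are also near-max-margin for a larger one.
-/

namespace ExtremalMargin

/-! ### Moment generating function of the uniform distribution on the sphere -/

/-- The map `s ↦ cosh (√s * x)` is convex, with the line `s ↦ cosh (√m * x) + D * (s - m)` as a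
tangent; here `s = r ^ 2`. The tangent inequality holds term by term in the power series. -/
theorem exists_cosh_tangent {m : ℝ} (hm : 0 < m) (x : ℝ) :
    ∃ D : ℝ, 0 ≤ D ∧ ∀ r : ℝ,
      Real.cosh (√m * x) + D * r ^ 2 ≤ Real.cosh (r * x) + D * m := by
  have hsum : Summable fun k : ℕ => (k : ℝ) * (√m * x) ^ (2 * k) / ((2 * k).factorial : ℝ) := by
    refine Summable.of_nonneg_of_le (fun k => ?_) (fun k => ?_)
      (Real.hasSum_cosh (√2 * (√m * x))).summable
    · have := (even_two_mul k).pow_nonneg (√m * x)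
      positivity
    · have h := (even_two_mul k).pow_nonneg (√m * x)
      have h2 : (k : ℝ) ≤ (√2) ^ (2 * k) := by
        rw [pow_mul, Real.sq_sqrt (by norm_num)]
        exact_mod_cast k.lt_two_pow_self.le
      rw [mul_pow (√2)]
      gcongr
  refine ⟨(∑' k : ℕ, (k : ℝ) * (√m * x) ^ (2 * k) / ((2 * k).factorial : ℝ)) / m, ?_, fun r => ?_⟩
  · refine div_nonneg (tsum_nonneg fun k => ?_) hm.le
    have := (even_two_mul k).pow_nonneg (√m * x)
    positivity
  · have h1 := (Real.hasSum_cosh (√m * x)).add (hsum.hasSum.mul_right ((r ^ 2 - m) / m))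
    have h := hasSum_le (fun k => ?_) h1 (Real.hasSum_cosh (r * x))
    · have e : ∀ T : ℝ, T * ((r ^ 2 - m) / m) = T / m * r ^ 2 - T / m * m := by
        intro T; field_simp
      rw [e] at h
      linarith
    · have hb := one_add_mul_le_pow (a := (r ^ 2 - m) / m)
        (by rw [le_div_iff₀ hm]; nlinarith [sq_nonneg r]) k
      have e1 : 1 + (r ^ 2 - m) / m = r ^ 2 / m := by field_simp; ring
      rw [e1] at hb
      have e2 : (√m * x) ^ (2 * k) = m ^ k * (x ^ 2) ^ k := by
        rw [mul_pow, pow_mul, pow_mul, Real.sq_sqrt hm.le]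
      have e3 : (r * x) ^ (2 * k) = (r ^ 2 / m) ^ k * (m ^ k * (x ^ 2) ^ k) := by
        rw [pow_mul, mul_pow r x, ← mul_assoc, ← mul_pow (r ^ 2 / m), div_mul_cancel₀ _ hm.ne',
          mul_pow]
      rw [e2, e3]
      have : 0 ≤ m ^ k * (x ^ 2) ^ k := by positivity
      rw [div_mul_eq_mul_div, ← add_div]
      gcongr
      nlinarith

section Sphere

variable {V : Type*} [NormedAddCommGroup V] [InnerProductSpace ℝ V]
    [FiniteDimensional ℝ V] [MeasurableSpace V] [BorelSpace V]

/-- Integration in polar coordinates. -/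
theorem lintegral_eq_lintegral_toSphere [Nontrivial V] {F : V → ℝ≥0∞} (hF : Measurable F) :
    ∫⁻ x, F x = ∫⁻ u : Metric.sphere (0 : V) 1,
      (∫⁻ r in Ioi (0 : ℝ), ENNReal.ofReal (r ^ (Module.finrank ℝ V - 1)) * F (r • (u : V)))
        ∂(volume : Measure V).toSphere := by
  have hmp := (volume : Measure V).measurePreserving_homeomorphUnitSphereProd
  have h0 : ∫⁻ x, F x = ∫⁻ x : ({0}ᶜ : Set V), F x ∂(volume.comap Subtype.val) := by
    rw [lintegral_subtype_comap (measurableSet_singleton _).compl, restrict_compl_singleton]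
  have h1 : ∀ x : ({0}ᶜ : Set V), F x = (fun p : Metric.sphere (0 : V) 1 × Ioi (0 : ℝ) =>
      F ((p.2 : ℝ) • (p.1 : V))) (homeomorphUnitSphereProd V x) := by
    intro x
    have := congrArg Subtype.val ((homeomorphUnitSphereProd V).symm_apply_apply x)
    conv_lhs => rw [← this]
    rfl
  have hmeas : Measurable fun p : Metric.sphere (0 : V) 1 × Ioi (0 : ℝ) =>
      F ((p.2 : ℝ) • (p.1 : V)) := hF.comp (by fun_prop)
  rw [h0, lintegral_congr h1, hmp.lintegral_comp hmeas, lintegral_prod _ hmeas.aemeasurable]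
  refine lintegral_congr fun u => ?_
  have hu : Measurable fun r : Ioi (0 : ℝ) => F ((r : ℝ) • (u : V)) := hF.comp (by fun_prop)
  rw [Measure.volumeIoiPow, lintegral_withDensity_eq_lintegral_mul _ (by fun_prop) hu]
  simp only [Pi.mul_apply]
  rw [lintegral_subtype_comap measurableSet_Ioi
    (fun r : ℝ => ENNReal.ofReal (r ^ (Module.finrank ℝ V - 1)) * F (r • (u : V)))]

theorem lintegral_pow_mul_exp_neg_sq (k : ℕ) :
    ∫⁻ r in Ioi (0 : ℝ), ENNReal.ofReal (r ^ k) * ENNReal.ofReal (Real.exp (-r ^ 2 / 2)) =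
      ENNReal.ofReal ((1 / 2 : ℝ) ^ (-((k : ℝ) + 1) / 2) * (1 / 2) *
        Real.Gamma (((k : ℝ) + 1) / 2)) := by
  rw [← integral_rpow_mul_exp_neg_mul_rpow (p := 2) (q := k) (b := 1 / 2) (by norm_num)
    (by have := k.cast_nonneg (α := ℝ); linarith) (by norm_num),
    ofReal_integral_eq_lintegral_ofReal]
  · refine setLIntegral_congr_fun measurableSet_Ioi fun r hr => ?_
    have hr : 0 < r := hr
    rw [← ENNReal.ofReal_mul (by positivity)]
    norm_num
    ring_nf
  · have := integrableOn_rpow_mul_exp_neg_mul_sq (b := 1 / 2) (by norm_num) (s := k)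
      (by have := k.cast_nonneg (α := ℝ); linarith)
    simpa [IntegrableOn] using this
  · filter_upwards [ae_restrict_mem measurableSet_Ioi] with r hr
    have hr : 0 < r := hr
    positivity

/-- The second moment of a standard Gaussian vector in dimension `m` is `m`, in radial form. -/
theorem lintegral_pow_succ_succ_mul_exp_neg_sq {m : ℕ} (hm : 1 ≤ m) :
    ∫⁻ r in Ioi (0 : ℝ), ENNReal.ofReal (r ^ (m + 1)) * ENNReal.ofReal (Real.exp (-r ^ 2 / 2)) =
      ENNReal.ofReal m * ∫⁻ r in Ioi (0 : ℝ),
        ENNReal.ofReal (r ^ (m - 1)) * ENNReal.ofReal (Real.exp (-r ^ 2 / 2)) := by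
  have hm0 : (0 : ℝ) < m := by exact_mod_cast hm
  rw [lintegral_pow_mul_exp_neg_sq, lintegral_pow_mul_exp_neg_sq, ← ENNReal.ofReal_mul hm0.le]
  congr 1
  push_cast [Nat.cast_sub hm]
  have e1 : ((m : ℝ) + 1 + 1) / 2 = m / 2 + 1 := by ring
  have e2 : (-((m : ℝ) + 1 + 1)) / 2 = -(m : ℝ) / 2 - 1 := by ring
  rw [e1, e2, Real.Gamma_add_one (by positivity), Real.rpow_sub_one (by norm_num)]
  simp
  ring

/-- Completing the square, with the normalization of the Gaussian density left implicit. -/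
theorem lintegral_cosh_inner_gaussian (a : V) :
    ∫⁻ x : V, ENNReal.ofReal (Real.cosh ⟪a, x⟫_ℝ) * ENNReal.ofReal (Real.exp (-‖x‖ ^ 2 / 2)) =
      ENNReal.ofReal (Real.exp (‖a‖ ^ 2 / 2)) *
        ∫⁻ x : V, ENNReal.ofReal (Real.exp (-‖x‖ ^ 2 / 2)) := by
  have key : ∀ b : V, ∫⁻ x : V, ENNReal.ofReal (Real.exp (⟪b, x⟫_ℝ - ‖x‖ ^ 2 / 2)) =
      ENNReal.ofReal (Real.exp (‖b‖ ^ 2 / 2)) *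
        ∫⁻ x : V, ENNReal.ofReal (Real.exp (-‖x‖ ^ 2 / 2)) := by
    intro b
    rw [← lintegral_sub_right_eq_self (fun x : V => ENNReal.ofReal (Real.exp (-‖x‖ ^ 2 / 2))) b,
      ← lintegral_const_mul _ (by fun_prop)]
    refine lintegral_congr fun x => ?_
    rw [← ENNReal.ofReal_mul (by positivity), ← Real.exp_add, norm_sub_sq_real,
      real_inner_comm]
    ring_nf
  have h1 := key a
  have h2 := key (-a)
  rw [norm_neg] at h2
  have e : ∀ x : V, ENNReal.ofReal (Real.cosh ⟪a, x⟫_ℝ) * ENNReal.ofReal (Real.exp (-‖x‖ ^ 2 / 2)) =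
      ENNReal.ofReal (1 / 2) * (ENNReal.ofReal (Real.exp (⟪a, x⟫_ℝ - ‖x‖ ^ 2 / 2)) +
        ENNReal.ofReal (Real.exp (⟪-a, x⟫_ℝ - ‖x‖ ^ 2 / 2))) := by
    intro x
    rw [← ENNReal.ofReal_mul (by positivity), ← ENNReal.ofReal_add (by positivity) (by positivity),
      ← ENNReal.ofReal_mul (by positivity), Real.cosh_eq, inner_neg_left]
    congr 1
    rw [sub_eq_add_neg, sub_eq_add_neg, Real.exp_add, Real.exp_add, neg_div]
    ring
  rw [lintegral_congr e, lintegral_const_mul _ (by fun_prop), lintegral_add_left (by fun_prop),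
    h1, h2, ← two_mul, ← mul_assoc, ← ENNReal.ofReal_ofNat 2, ← ENNReal.ofReal_mul (by norm_num)]
  norm_num

/-- Averaging over the norm of a Gaussian vector can only increase the mean of `cosh` when compared
with the constant norm `√m`, since the squared norm has mean `m`. -/
theorem lintegral_cosh_inner_toSphere_le [Nontrivial V] (a : V) :
    ∫⁻ u : Metric.sphere (0 : V) 1,
        ENNReal.ofReal (Real.cosh (√(Module.finrank ℝ V) * ⟪a, (u : V)⟫_ℝ))
          ∂(volume : Measure V).toSphere ≤
      ENNReal.ofReal (Real.exp (‖a‖ ^ 2 / 2)) * (volume : Measure V).toSphere univ := by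
  set m := Module.finrank ℝ V with hmdef
  have hm : 1 ≤ m := Module.finrank_pos
  have hm0 : (0 : ℝ) < m := by exact_mod_cast hm
  set I := ∫⁻ r in Ioi (0 : ℝ), ENNReal.ofReal (r ^ (m - 1)) *
    ENNReal.ofReal (Real.exp (-r ^ 2 / 2)) with hI
  have hIpos : I ≠ 0 := by
    rw [hI, lintegral_pow_mul_exp_neg_sq]
    have : 0 < Real.Gamma ((((m - 1 : ℕ) : ℝ) + 1) / 2) := Real.Gamma_pos_of_pos (by positivity)
    simp only [ne_eq, ENNReal.ofReal_eq_zero, not_le]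
    positivity
  have hIfin : I ≠ ∞ := by
    rw [hI, lintegral_pow_mul_exp_neg_sq]; exact ENNReal.ofReal_ne_top
  have hnorm : ∀ u : Metric.sphere (0 : V) 1, ∀ r : ℝ, ‖r • (u : V)‖ ^ 2 = r ^ 2 := by
    intro u r
    rw [norm_smul, mul_pow, norm_eq_of_mem_sphere]
    simp
  -- the radial Jensen inequality, for each direction
  have hjensen : ∀ u : Metric.sphere (0 : V) 1,
      ENNReal.ofReal (Real.cosh (√m * ⟪a, (u : V)⟫_ℝ)) * I ≤
        ∫⁻ r in Ioi (0 : ℝ), ENNReal.ofReal (r ^ (m - 1)) *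
          (ENNReal.ofReal (Real.cosh ⟪a, r • (u : V)⟫_ℝ) *
            ENNReal.ofReal (Real.exp (-‖r • (u : V)‖ ^ 2 / 2))) := by
    intro u
    -- the term `D * (r ^ 2 - m)` has mean zero; its two parts are added to the two sides to stay
    -- within nonnegative integrands
    obtain ⟨D, hD, hle⟩ := exists_cosh_tangent hm0 ⟪a, (u : V)⟫_ℝ
    refine ENNReal.le_of_add_le_add_right (a := ENNReal.ofReal (D * m) * I)
      (ENNReal.mul_ne_top ENNReal.ofReal_ne_top hIfin) ?_
    have hJ : ENNReal.ofReal (D * m) * I = ∫⁻ r in Ioi (0 : ℝ), ENNReal.ofReal D *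
        (ENNReal.ofReal (r ^ (m + 1)) * ENNReal.ofReal (Real.exp (-r ^ 2 / 2))) := by
      rw [lintegral_const_mul _ (by fun_prop), lintegral_pow_succ_succ_mul_exp_neg_sq hm,
        ENNReal.ofReal_mul hD, mul_assoc]
    calc _ = ∫⁻ r in Ioi (0 : ℝ), (ENNReal.ofReal (Real.cosh (√m * ⟪a, (u : V)⟫_ℝ)) *
          (ENNReal.ofReal (r ^ (m - 1)) * ENNReal.ofReal (Real.exp (-r ^ 2 / 2))) +
          ENNReal.ofReal D *
          (ENNReal.ofReal (r ^ (m + 1)) * ENNReal.ofReal (Real.exp (-r ^ 2 / 2)))) := by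
            rw [lintegral_add_left (by fun_prop), lintegral_const_mul _ (by fun_prop), hJ]
      _ ≤ ∫⁻ r in Ioi (0 : ℝ), (ENNReal.ofReal (r ^ (m - 1)) *
          (ENNReal.ofReal (Real.cosh ⟪a, r • (u : V)⟫_ℝ) *
            ENNReal.ofReal (Real.exp (-‖r • (u : V)‖ ^ 2 / 2))) +
          ENNReal.ofReal (D * m) *
          (ENNReal.ofReal (r ^ (m - 1)) * ENNReal.ofReal (Real.exp (-r ^ 2 / 2)))) := by
            refine setLIntegral_mono (by fun_prop) fun r hr => ?_
            have hr : 0 < r := hr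
            rw [hnorm, inner_smul_right]
            have hp : 0 ≤ r ^ (m - 1) := by positivity
            have hp' : 0 ≤ r ^ (m + 1) := by positivity
            have hc := (Real.cosh_pos (√m * ⟪a, (u : V)⟫_ℝ)).le
            have hc' := (Real.cosh_pos (r * ⟪a, (u : V)⟫_ℝ)).le
            have hDm : 0 ≤ D * m := by positivity
            simp only [← ENNReal.ofReal_mul hp, ← ENNReal.ofReal_mul hp', ← ENNReal.ofReal_mul hc,
              ← ENNReal.ofReal_mul hc', ← ENNReal.ofReal_mul hD, ← ENNReal.ofReal_mul hDm]
            rw [← ENNReal.ofReal_add (by positivity) (by positivity),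
              ← ENNReal.ofReal_add (by positivity) (by positivity)]
            refine ENNReal.ofReal_le_ofReal ?_
            have e : r ^ (m + 1) = r ^ (m - 1) * r ^ 2 := by
              rw [← pow_add]; congr 1; omega
            rw [e]
            have := mul_le_mul_of_nonneg_right (hle r)
              (show 0 ≤ r ^ (m - 1) * Real.exp (-r ^ 2 / 2) by positivity)
            linarith
      _ = _ := by
            rw [lintegral_add_right _ (by fun_prop), lintegral_const_mul _ (by fun_prop)]
  have hgauss := lintegral_cosh_inner_gaussian a
  rw [lintegral_eq_lintegral_toSphere (by fun_prop),
    lintegral_eq_lintegral_toSphere (F := fun x : V => ENNReal.ofReal (Real.exp (-‖x‖ ^ 2 / 2)))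
      (by fun_prop)] at hgauss
  simp only [hnorm] at hgauss hjensen
  rw [lintegral_const] at hgauss
  have := (lintegral_mono (μ := (volume : Measure V).toSphere) hjensen).trans_eq hgauss
  rw [lintegral_mul_const _ (by fun_prop), mul_comm _ (I * _), mul_comm I, mul_assoc,
    mul_comm I, ← mul_assoc] at this
  rw [mul_comm (ENNReal.ofReal (Real.exp _))]
  exact (ENNReal.mul_le_mul_iff_left hIpos hIfin).1 this

theorem measurePreserving_neg_toSphere :
    MeasurePreserving (fun u : Metric.sphere (0 : V) 1 => -u)
      (volume : Measure V).toSphere (volume : Measure V).toSphere := by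
  refine ⟨by fun_prop, Measure.ext fun s hs => ?_⟩
  have hm : Measurable (fun u : Metric.sphere (0 : V) 1 => -u) := by fun_prop
  rw [Measure.map_apply hm hs, Measure.toSphere_apply' _ (hm hs), Measure.toSphere_apply' _ hs,
    ← Measure.measure_neg]
  congr 2
  ext x
  simp only [Set.mem_neg, Set.mem_smul, Set.mem_image, Set.mem_preimage]
  constructor
  · rintro ⟨r, hr, _, ⟨u, hu, rfl⟩, h⟩
    exact ⟨r, hr, _, ⟨-u, hu, rfl⟩, by simp [h]⟩
  · rintro ⟨r, hr, _, ⟨u, hu, rfl⟩, h⟩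
    exact ⟨r, hr, _, ⟨-u, by simpa using hu, rfl⟩, by simp [h]⟩

instance [Nontrivial V] : IsProbabilityMeasure (uniformUnitSphere V) := by
  refine ⟨?_⟩
  rw [uniformUnitSphere, Measure.smul_apply, smul_eq_mul]
  exact ENNReal.inv_mul_cancel
    (Measure.measure_univ_ne_zero.2 (Measure.toSphere_ne_zero (volume : Measure V)))
    (measure_ne_top _ _)

/-- A uniform point of the unit sphere in dimension `m` is sub-Gaussian with variance proxy `1 / m`:
compare with a Gaussian vector, whose norm is independent of its direction, and apply Jensen's
inequality to the norm. -/
theorem lintegral_exp_inner_uniformUnitSphere_le [Nontrivial V] (a : V) :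
    ∫⁻ u, ENNReal.ofReal (Real.exp ⟪a, (u : V)⟫_ℝ) ∂(uniformUnitSphere V) ≤
      ENNReal.ofReal (Real.exp (‖a‖ ^ 2 / (2 * Module.finrank ℝ V))) := by
  have hm0 : (0 : ℝ) < Module.finrank ℝ V := by exact_mod_cast Module.finrank_pos
  have hs : 0 < √(Module.finrank ℝ V : ℝ) := Real.sqrt_pos.2 hm0
  have hsym : ∫⁻ u : Metric.sphere (0 : V) 1, ENNReal.ofReal (Real.exp (-⟪a, (u : V)⟫_ℝ))
      ∂(volume : Measure V).toSphere = ∫⁻ u : Metric.sphere (0 : V) 1,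
        ENNReal.ofReal (Real.exp ⟪a, (u : V)⟫_ℝ) ∂(volume : Measure V).toSphere := by
    rw [← measurePreserving_neg_toSphere.lintegral_comp (by fun_prop)]
    simp
  have hcosh : ∫⁻ u : Metric.sphere (0 : V) 1, ENNReal.ofReal (Real.exp ⟪a, (u : V)⟫_ℝ)
      ∂(volume : Measure V).toSphere = ∫⁻ u : Metric.sphere (0 : V) 1,
        ENNReal.ofReal (Real.cosh ⟪a, (u : V)⟫_ℝ) ∂(volume : Measure V).toSphere := by
    have e : ∀ u : Metric.sphere (0 : V) 1, ENNReal.ofReal (Real.cosh ⟪a, (u : V)⟫_ℝ) =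
        ENNReal.ofReal (1 / 2) * (ENNReal.ofReal (Real.exp ⟪a, (u : V)⟫_ℝ) +
          ENNReal.ofReal (Real.exp (-⟪a, (u : V)⟫_ℝ))) := by
      intro u
      rw [← ENNReal.ofReal_add (by positivity) (by positivity),
        ← ENNReal.ofReal_mul (by positivity), Real.cosh_eq]
      ring_nf
    rw [lintegral_congr e, lintegral_const_mul _ (by fun_prop), lintegral_add_left (by fun_prop),
      hsym, ← two_mul, ← mul_assoc, ← ENNReal.ofReal_ofNat 2, ← ENNReal.ofReal_mul (by norm_num)]
    norm_num
  have h := lintegral_cosh_inner_toSphere_le ((√(Module.finrank ℝ V : ℝ))⁻¹ • a)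
  simp only [inner_smul_left, norm_smul, RCLike.conj_to_real, mul_inv_cancel_left₀ hs.ne'] at h
  rw [uniformUnitSphere, lintegral_smul_measure, hcosh, smul_eq_mul]
  refine (mul_le_mul_right h _).trans_eq ?_
  rw [mul_comm, mul_assoc, ENNReal.mul_inv_cancel
    (Measure.measure_univ_ne_zero.2 (Measure.toSphere_ne_zero (volume : Measure V)))
    (measure_ne_top _ _), mul_one,
    mul_pow, norm_inv, Real.norm_of_nonneg hs.le, inv_pow, Real.sq_sqrt hm0.le]
  congr 2
  field_simp

end Sphere

/-! ### Norms of combinations of independent sub-Gaussian unit vectors -/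

section Concentration

variable {α : Type*} [MeasurableSpace α] {P : Measure α} [IsProbabilityMeasure P]
  {E : Type*} [NormedAddCommGroup E] [InnerProductSpace ℝ E] [FiniteDimensional ℝ E]
  [MeasurableSpace E] [BorelSpace E] {h : α → E} {m : ℝ}

omit [IsProbabilityMeasure P] in
theorem lintegral_exp_norm_sq_add_smul_le (hh : Measurable h)
    (hnorm : ∀ᵐ p ∂P, ‖h p‖ = 1)
    (hmgf : ∀ a : E, ∫⁻ p, ENNReal.ofReal (Real.exp ⟪a, h p⟫_ℝ) ∂P ≤
      ENNReal.ofReal (Real.exp (‖a‖ ^ 2 / (2 * m)))) (θ c : ℝ) (s : E) :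
    ∫⁻ p, ENNReal.ofReal (Real.exp (θ * ‖c • h p + s‖ ^ 2)) ∂P ≤
      ENNReal.ofReal (Real.exp (θ * c ^ 2)) *
        ENNReal.ofReal (Real.exp (θ * (1 + 2 * θ * c ^ 2 / m) * ‖s‖ ^ 2)) := by
  have e : ∀ᵐ p ∂P, ENNReal.ofReal (Real.exp (θ * ‖c • h p + s‖ ^ 2)) =
      ENNReal.ofReal (Real.exp (θ * (c ^ 2 + ‖s‖ ^ 2))) *
        ENNReal.ofReal (Real.exp ⟪(2 * θ * c) • s, h p⟫_ℝ) := by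
    filter_upwards [hnorm] with p hp
    rw [← ENNReal.ofReal_mul (by positivity), ← Real.exp_add, norm_add_sq_real, norm_smul, hp,
      inner_smul_left, inner_smul_left, real_inner_comm s]
    simp only [RCLike.conj_to_real, mul_one, Real.norm_eq_abs, sq_abs]
    ring_nf
  rw [lintegral_congr_ae e, lintegral_const_mul _ (by fun_prop)]
  refine (mul_le_mul_right (hmgf _) _).trans_eq ?_
  rw [← ENNReal.ofReal_mul (by positivity), ← ENNReal.ofReal_mul (by positivity), ← Real.exp_add,
    ← Real.exp_add, norm_smul, mul_pow, Real.norm_eq_abs, sq_abs]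
  ring_nf

omit [IsProbabilityMeasure P] in
theorem lintegral_pi_fin_succ [SigmaFinite P] {n : ℕ} {F : (Fin (n + 1) → α) → ℝ≥0∞}
    (hF : Measurable F) :
    ∫⁻ S, F S ∂(Measure.pi fun _ => P) = ∫⁻ S : Fin n → α, (∫⁻ p, F (Fin.cons p S) ∂P)
      ∂(Measure.pi fun _ => P) := by
  have hmp := (measurePreserving_piFinSuccAbove (fun _ : Fin (n + 1) => P) 0).symm
  have hmeas : Measurable fun q : α × (Fin n → α) =>
      F ((MeasurableEquiv.piFinSuccAbove (fun _ => α) 0).symm q) :=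
    hF.comp (MeasurableEquiv.measurable _)
  rw [← hmp.lintegral_comp hF, lintegral_prod_symm _ hmeas.aemeasurable]
  simp only [MeasurableEquiv.piFinSuccAbove_symm_apply, Fin.insertNthEquiv, Fin.insertNth_zero]
  rfl

/-- Integrating out one vector `c • h` only changes the parameter of the exponential, so that the
moment generating function of the squared norm of a sum obeys a deterministic recursion. -/
theorem lintegral_pi_exp_norm_sq_succ_le (hh : Measurable h)
    (hnorm : ∀ᵐ p ∂P, ‖h p‖ = 1)
    (hmgf : ∀ a : E, ∫⁻ p, ENNReal.ofReal (Real.exp ⟪a, h p⟫_ℝ) ∂P ≤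
      ENNReal.ofReal (Real.exp (‖a‖ ^ 2 / (2 * m)))) {n : ℕ} (θ : ℝ) (c : Fin (n + 1) → ℝ) :
    ∫⁻ S, ENNReal.ofReal (Real.exp (θ * ‖∑ i, c i • h (S i)‖ ^ 2)) ∂(Measure.pi fun _ => P) ≤
      ENNReal.ofReal (Real.exp (θ * c 0 ^ 2)) *
        ∫⁻ S : Fin n → α, ENNReal.ofReal (Real.exp (θ * (1 + 2 * θ * c 0 ^ 2 / m) *
          ‖∑ i, c i.succ • h (S i)‖ ^ 2)) ∂(Measure.pi fun _ => P) := by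
  rw [lintegral_pi_fin_succ (by fun_prop), ← lintegral_const_mul _ (by fun_prop)]
  refine lintegral_mono fun S => ?_
  simp only [Fin.sum_univ_succ, Fin.cons_zero, Fin.cons_succ]
  exact lintegral_exp_norm_sq_add_smul_le hh hnorm hmgf _ _ _

/-- For a negative exponent `-θ` the recursion decreases `θ`; the bound keeps its second-order
term. -/
theorem lintegral_exp_neg_norm_sq_sum_le (hm : 0 < m) (hh : Measurable h)
    (hnorm : ∀ᵐ p ∂P, ‖h p‖ = 1)
    (hmgf : ∀ a : E, ∫⁻ p, ENNReal.ofReal (Real.exp ⟪a, h p⟫_ℝ) ∂P ≤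
      ENNReal.ofReal (Real.exp (‖a‖ ^ 2 / (2 * m)))) {n : ℕ} (θ : ℝ) (c : Fin n → ℝ)
    (hθ : 0 ≤ θ) (hθm : 2 * θ * ∑ i, c i ^ 2 ≤ m) :
    ∫⁻ S, ENNReal.ofReal (Real.exp (-θ * ‖∑ i, c i • h (S i)‖ ^ 2)) ∂(Measure.pi fun _ => P) ≤
      ENNReal.ofReal (Real.exp (-θ * (∑ i, c i ^ 2) + 2 * θ ^ 2 * (∑ i, c i ^ 2) ^ 2 / m)) := by
  induction n generalizing θ with
  | zero => simp
  | succ n ih =>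
    rw [Fin.sum_univ_succ] at hθm ⊢
    set a := c 0 ^ 2
    set s := ∑ i : Fin n, c i.succ ^ 2
    have ha : 0 ≤ a := sq_nonneg _
    have hs : 0 ≤ s := Finset.sum_nonneg fun i _ => sq_nonneg _
    have hy0 : 0 ≤ 2 * θ * a / m := by positivity
    have hy1 : 2 * θ * a / m ≤ 1 := by
      rw [div_le_one hm]; nlinarith [mul_nonneg hθ hs]
    set y := 2 * θ * a / m with hy
    have hle : θ * (1 - y) ≤ θ := by nlinarith
    have h0 : 0 ≤ θ * (1 - y) := mul_nonneg hθ (by linarith)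
    have e : -θ * (1 + 2 * -θ * a / m) = -(θ * (1 - y)) := by rw [hy]; ring
    refine (lintegral_pi_exp_norm_sq_succ_le hh hnorm hmgf _ c).trans ?_
    change _ * ∫⁻ S : Fin n → α, ENNReal.ofReal (Real.exp (-θ * (1 + 2 * -θ * a / m) * _)) ∂_ ≤ _
    rw [e]
    refine (mul_le_mul_right (ih (θ * (1 - y)) _ h0 ?_) _).trans ?_
    · change 2 * _ * s ≤ m
      nlinarith [mul_le_mul_of_nonneg_right hle hs, mul_nonneg hθ ha]
    rw [← ENNReal.ofReal_mul (by positivity), ← Real.exp_add]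
    refine ENNReal.ofReal_le_ofReal (Real.exp_le_exp.2 ?_)
    change -θ * a + (-(θ * (1 - y)) * s + 2 * (θ * (1 - y)) ^ 2 * s ^ 2 / m) ≤ _
    have h1 : 2 * (θ * (1 - y)) ^ 2 * s ^ 2 / m ≤ 2 * θ ^ 2 * s ^ 2 / m := by gcongr
    have h2 : θ * y * s = 2 * θ ^ 2 * (a * s) / m := by rw [hy]; ring
    have h3 : 2 * θ ^ 2 * (a * s + s ^ 2) / m ≤ 2 * θ ^ 2 * (a + s) ^ 2 / m := by
      gcongr
      nlinarith [mul_nonneg ha hs]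
    have h4 : 2 * θ ^ 2 * (a * s + s ^ 2) / m =
        2 * θ ^ 2 * (a * s) / m + 2 * θ ^ 2 * s ^ 2 / m := by
      ring
    nlinarith

/-- The induction step for positive exponents, with `x` and `y` the rescaled contributions of the
remaining vectors and of the one integrated out. -/
theorem add_inv_one_sub_le {x y : ℝ} (hx : 0 ≤ x) (hy : 0 ≤ y) (hxy : x + y < 1) :
    y + (1 - x * (1 + y))⁻¹ ≤ (1 - (x + y))⁻¹ := by
  have h1 : 0 < 1 - (x + y) := by linarith
  have h2 : 0 < 1 - x * (1 + y) := by nlinarith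
  have h3 : 1 - x * (1 + y) ≤ 1 := by nlinarith
  have h4 : (1 - (x + y))⁻¹ - (1 - x * (1 + y))⁻¹ =
      y * ((1 - x) / (1 - (x + y)) * (1 - x * (1 + y))⁻¹) := by
    field_simp; ring
  have h5 : 1 ≤ (1 - x) / (1 - (x + y)) := by rw [le_div_iff₀ h1]; linarith
  have h6 : 1 ≤ (1 - x * (1 + y))⁻¹ := (one_le_inv₀ h2).2 h3
  nlinarith [mul_le_mul_of_nonneg_left (one_le_mul_of_one_le_of_one_le h5 h6) hy]

/-- For a positive exponent the recursion increases `θ`; in the variable `1 / θ` the total decrease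
is at most `2 / m * ∑ i, c i ^ 2`, which is where the closed form of the bound comes from. -/
theorem lintegral_exp_norm_sq_sum_le (hm : 0 < m) (hh : Measurable h)
    (hnorm : ∀ᵐ p ∂P, ‖h p‖ = 1)
    (hmgf : ∀ a : E, ∫⁻ p, ENNReal.ofReal (Real.exp ⟪a, h p⟫_ℝ) ∂P ≤
      ENNReal.ofReal (Real.exp (‖a‖ ^ 2 / (2 * m)))) {n : ℕ} (θ : ℝ) (c : Fin n → ℝ)
    (hθ : 0 ≤ θ) (hθm : 2 * θ / m * ∑ i, c i ^ 2 < 1) :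
    ∫⁻ S, ENNReal.ofReal (Real.exp (θ * ‖∑ i, c i • h (S i)‖ ^ 2)) ∂(Measure.pi fun _ => P) ≤
      ENNReal.ofReal (Real.exp (m / 2 * ((1 - 2 * θ / m * ∑ i, c i ^ 2)⁻¹ - 1))) := by
  induction n generalizing θ with
  | zero => simp
  | succ n ih =>
    rw [Fin.sum_univ_succ] at hθm ⊢
    set a := c 0 ^ 2
    set s := ∑ i : Fin n, c i.succ ^ 2
    have ha : 0 ≤ a := sq_nonneg _
    have hs : 0 ≤ s := Finset.sum_nonneg fun i _ => sq_nonneg _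
    have hx0 : 0 ≤ 2 * θ / m * s := by positivity
    have hy0 : 0 ≤ 2 * θ / m * a := by positivity
    have hxy : 2 * θ / m * s + 2 * θ / m * a < 1 := by linarith
    have e : 2 * (θ * (1 + 2 * θ * a / m)) / m * s =
        2 * θ / m * s * (1 + 2 * θ / m * a) := by ring
    refine (lintegral_pi_exp_norm_sq_succ_le hh hnorm hmgf _ c).trans ?_
    refine (mul_le_mul_right (ih (θ * (1 + 2 * θ * a / m)) _ (by positivity) ?_) _).trans ?_
    · change _ * s < 1
      rw [e]
      nlinarith
    rw [← ENNReal.ofReal_mul (by positivity), ← Real.exp_add]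
    refine ENNReal.ofReal_le_ofReal (Real.exp_le_exp.2 ?_)
    change θ * a + m / 2 * ((1 - 2 * (θ * (1 + 2 * θ * a / m)) / m * s)⁻¹ - 1) ≤ _
    rw [e]
    have h1 := add_inv_one_sub_le hx0 hy0 hxy
    have h2 : θ * a = m / 2 * (2 * θ / m * a) := by field_simp
    have h3 : 2 * θ / m * (a + s) = 2 * θ / m * s + 2 * θ / m * a := by ring
    rw [h2, h3, ← mul_add]
    gcongr
    linarith

/-- Chernoff bounds for both tails of the squared norm of a unit combination. -/
theorem measure_norm_sq_sum_deviation_le (hm : 0 < m) (hh : Measurable h)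
    (hnorm : ∀ᵐ p ∂P, ‖h p‖ = 1)
    (hmgf : ∀ a : E, ∫⁻ p, ENNReal.ofReal (Real.exp ⟪a, h p⟫_ℝ) ∂P ≤
      ENNReal.ofReal (Real.exp (‖a‖ ^ 2 / (2 * m)))) {n : ℕ} (c : Fin n → ℝ)
    (hc : ∑ i, c i ^ 2 = 1) {t : ℝ} (ht0 : 0 ≤ t) (ht1 : t ≤ 1) :
    (Measure.pi fun _ => P) {S : Fin n → α | t ≤ |‖∑ i, c i • h (S i)‖ ^ 2 - 1|} ≤
      ENNReal.ofReal (2 * Real.exp (-(m * t ^ 2 / 16))) := by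
  have markov : ∀ (θ b : ℝ), (Measure.pi fun _ => P)
      {S : Fin n → α | b ≤ θ * ‖∑ i, c i • h (S i)‖ ^ 2} ≤ ENNReal.ofReal (Real.exp (-b)) *
        ∫⁻ S, ENNReal.ofReal (Real.exp (θ * ‖∑ i, c i • h (S i)‖ ^ 2))
          ∂(Measure.pi fun _ => P) := by
    intro θ b
    rw [← lintegral_const_mul _ (by fun_prop)]
    have hmeas : Measurable fun S : Fin n → α => ENNReal.ofReal (Real.exp (-b)) *
        ENNReal.ofReal (Real.exp (θ * ‖∑ i, c i • h (S i)‖ ^ 2)) := by fun_prop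
    refine (measure_mono fun S hS => ?_).trans ((meas_ge_le_lintegral_div hmeas.aemeasurable
      one_ne_zero ENNReal.one_ne_top).trans_eq (by rw [div_one]))
    simp only [mem_ofPred_eq] at hS ⊢
    rw [← ENNReal.ofReal_mul (by positivity), ← Real.exp_add, ENNReal.one_le_ofReal]
    exact Real.one_le_exp (by linarith)
  -- near-optimal exponents: `m * t / 8` for the upper tail, `-(m * t / 4)` for the lower one
  have hup : (Measure.pi fun _ => P) {S : Fin n → α | m * t / 8 * (1 + t) ≤
      m * t / 8 * ‖∑ i, c i • h (S i)‖ ^ 2} ≤ ENNReal.ofReal (Real.exp (-(m * t ^ 2 / 16))) := by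
    have ex : 2 * (m * t / 8) / m * 1 = t / 4 := by field_simp; ring
    refine (markov _ _).trans ((mul_le_mul_right (lintegral_exp_norm_sq_sum_le hm hh hnorm hmgf
      _ c (by positivity) ?_) _).trans ?_)
    · rw [hc, ex]; linarith
    rw [← ENNReal.ofReal_mul (by positivity), ← Real.exp_add, hc, ex]
    refine ENNReal.ofReal_le_ofReal (Real.exp_le_exp.2 ?_)
    have h1 : (1 - t / 4)⁻¹ ≤ 1 + t / 4 + t ^ 2 / 8 := by
      rw [inv_le_iff_one_le_mul₀ (by linarith)]
      nlinarith [mul_nonneg (sq_nonneg t) (sub_nonneg.2 ht1)]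
    nlinarith [mul_le_mul_of_nonneg_left h1 hm.le]
  have hlow : (Measure.pi fun _ => P) {S : Fin n → α | -(m * t / 4) * (1 - t) ≤
      -(m * t / 4) * ‖∑ i, c i • h (S i)‖ ^ 2} ≤ ENNReal.ofReal (Real.exp (-(m * t ^ 2 / 16))) := by
    refine (markov _ _).trans ((mul_le_mul_right (lintegral_exp_neg_norm_sq_sum_le hm hh hnorm hmgf
      _ c (by positivity) ?_) _).trans ?_)
    · rw [hc]; nlinarith
    rw [← ENNReal.ofReal_mul (by positivity), ← Real.exp_add, hc]
    refine ENNReal.ofReal_le_ofReal (Real.exp_le_exp.2 ?_)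
    have h1 : 2 * (m * t / 4) ^ 2 * 1 ^ 2 / m = m * t ^ 2 / 8 := by field_simp; ring
    rw [h1]
    nlinarith [mul_nonneg hm.le (sq_nonneg t)]
  have hsub : {S : Fin n → α | t ≤ |‖∑ i, c i • h (S i)‖ ^ 2 - 1|} ⊆
      {S | m * t / 8 * (1 + t) ≤ m * t / 8 * ‖∑ i, c i • h (S i)‖ ^ 2} ∪
        {S | -(m * t / 4) * (1 - t) ≤ -(m * t / 4) * ‖∑ i, c i • h (S i)‖ ^ 2} := by
    intro S hS
    have h0 : 0 ≤ m * t := by positivity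
    rcases le_abs.1 (show t ≤ |‖∑ i, c i • h (S i)‖ ^ 2 - 1| from hS) with h | h
    · left
      rw [mem_ofPred_eq]
      exact mul_le_mul_of_nonneg_left (by linarith) (by linarith)
    · right
      rw [mem_ofPred_eq]
      exact mul_le_mul_of_nonpos_left (by linarith) (by linarith)
  refine (measure_mono hsub).trans ((measure_union_le _ _).trans
    ((add_le_add hup hlow).trans_eq ?_))
  rw [← ENNReal.ofReal_add (by positivity) (by positivity), two_mul]

end Concentration

/-! ### From a net of the sphere to all combinations -/

section Net

variable {X : Type*} [NormedAddCommGroup X] [InnerProductSpace ℝ X] [FiniteDimensional ℝ X]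

/-- A half-net of the unit sphere of size at most `5 ^ dim`: otherwise separated families could be
extended beyond the bound that volume comparison gives. -/
theorem exists_half_net_sphere (X : Type*) [NormedAddCommGroup X] [InnerProductSpace ℝ X]
    [FiniteDimensional ℝ X] :
    ∃ N : Finset X, (∀ y ∈ N, ‖y‖ = 1) ∧ N.card ≤ 5 ^ Module.finrank ℝ X ∧
      ∀ x : X, ‖x‖ = 1 → ∃ y ∈ N, ‖x - y‖ ≤ 1 / 2 := by
  classical
  have hcard : ∀ N : Finset X, (∀ y ∈ N, ‖y‖ = 1) →
      (∀ y ∈ N, ∀ z ∈ N, y ≠ z → 1 / 2 ≤ ‖y - z‖) → N.card ≤ 5 ^ Module.finrank ℝ X := by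
    intro N h1 h2
    have hinj : Function.Injective fun y : X => (2 : ℝ) • y := smul_right_injective X two_ne_zero
    rw [← Finset.card_image_of_injective N hinj]
    refine Besicovitch.card_le_of_separated _ ?_ ?_
    · simp only [Finset.mem_image]
      rintro _ ⟨y, hy, rfl⟩
      simp [norm_smul, h1 y hy]
    · simp only [Finset.mem_image]
      rintro _ ⟨y, hy, rfl⟩ _ ⟨z, hz, rfl⟩ hne
      have := h2 y hy z hz (fun h => hne (by rw [h]))
      rw [← smul_sub, norm_smul, Real.norm_ofNat]
      linarith
  by_contra! hcon
  have hext : ∀ k : ℕ, ∃ N : Finset X, N.card = k ∧ (∀ y ∈ N, ‖y‖ = 1) ∧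
      (∀ y ∈ N, ∀ z ∈ N, y ≠ z → 1 / 2 ≤ ‖y - z‖) := by
    intro k
    induction k with
    | zero => exact ⟨∅, by simp⟩
    | succ k ih =>
      obtain ⟨N, hk, h1, h2⟩ := ih
      obtain ⟨x, hx, hfar⟩ := hcon N h1 (hcard N h1 h2)
      refine ⟨insert x N, ?_, ?_, ?_⟩
      · rw [Finset.card_insert_of_notMem, hk]
        intro hxN
        have := hfar x hxN
        norm_num at this
      · simpa [hx] using h1
      · intro y hy z hz hne
        rcases Finset.mem_insert.1 hy with hy | hy <;> rcases Finset.mem_insert.1 hz with hz | hz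
        · exact absurd (hy.trans hz.symm) hne
        · rw [hy]; exact (hfar z hz).le
        · rw [hz, norm_sub_rev]; exact (hfar y hy).le
        · exact h2 y hy z hz hne
  obtain ⟨N, hk, h1, h2⟩ := hext (5 ^ Module.finrank ℝ X + 1)
  have := hcard N h1 h2
  omega

theorem norm_sq_smul_add_smul {F : Type*} [NormedAddCommGroup F] [InnerProductSpace ℝ F]
    (α β : ℝ) (u v : F) :
    ‖α • u + β • v‖ ^ 2 = α ^ 2 * ‖u‖ ^ 2 + 2 * α * β * ⟪u, v⟫_ℝ + β ^ 2 * ‖v‖ ^ 2 := by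
  rw [norm_add_sq_real, norm_smul, norm_smul, inner_smul_left, inner_smul_right, mul_pow, mul_pow,
    Real.norm_eq_abs, Real.norm_eq_abs, sq_abs, sq_abs, RCLike.conj_to_real]
  ring

/-- A linear map that is almost isometric on a half-net of the sphere is almost isometric. For a
unit vector `x` where the quadratic form `q z = ‖T z‖ ^ 2 - ‖z‖ ^ 2` is extremal and a net point `y`
near it, `4 * (q x - q y) = q (5/2 x - 3/2 y) - q (5/2 y - 3/2 x)`, and the right-hand side is at
most `31/8` times the extremal value. -/
theorem abs_norm_sq_sub_le_of_half_net {E : Type*} [NormedAddCommGroup E] [InnerProductSpace ℝ E]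
    (T : X →ₗ[ℝ] E) {N : Set X} (hN : ∀ y ∈ N, ‖y‖ = 1)
    (hnet : ∀ x : X, ‖x‖ = 1 → ∃ y ∈ N, ‖x - y‖ ≤ 1 / 2) {t : ℝ}
    (ht : ∀ y ∈ N, |‖T y‖ ^ 2 - 1| ≤ t) (x : X) :
    |‖T x‖ ^ 2 - ‖x‖ ^ 2| ≤ 32 * t * ‖x‖ ^ 2 := by
  rcases eq_or_ne x 0 with rfl | hx
  · simp
  have hT : Continuous T := T.continuous_of_finiteDimensional
  have hscale : ∀ z : X, z ≠ 0 → |‖T z‖ ^ 2 - ‖z‖ ^ 2| =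
      |‖T (‖z‖⁻¹ • z)‖ ^ 2 - 1| * ‖z‖ ^ 2 := by
    intro z hz
    have hz' : ‖z‖ ≠ 0 := norm_ne_zero_iff.2 hz
    rw [← abs_of_nonneg (sq_nonneg ‖z‖), ← abs_mul, abs_of_nonneg (sq_nonneg ‖z‖), map_smul,
      norm_smul, norm_inv, norm_norm]
    congr 1
    field_simp
  have hunit : ∀ z : X, z ≠ 0 → ‖(‖z‖⁻¹ • z)‖ = 1 := fun z hz => norm_smul_inv_norm (𝕜 := ℝ) hz
  obtain ⟨x₀, hx₀, hmax⟩ := (isCompact_sphere (0 : X) 1).exists_isMaxOn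
    ⟨‖x‖⁻¹ • x, by simpa using hunit x hx⟩
    (f := fun z => |‖T z‖ ^ 2 - 1|) (by fun_prop)
  have hx₀ : ‖x₀‖ = 1 := by simpa using hx₀
  set M := |‖T x₀‖ ^ 2 - 1| with hM
  have hMle : ∀ z : X, |‖T z‖ ^ 2 - ‖z‖ ^ 2| ≤ M * ‖z‖ ^ 2 := by
    intro z
    rcases eq_or_ne z 0 with rfl | hz
    · simp
    rw [hscale z hz]
    gcongr
    exact hmax (show ‖z‖⁻¹ • z ∈ Metric.sphere (0 : X) 1 by simpa using hunit z hz)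
  obtain ⟨y, hyN, hxy⟩ := hnet x₀ hx₀
  have hy := hN y hyN
  have hin : 7 / 8 ≤ ⟪x₀, y⟫_ℝ := by
    have h1 := norm_sub_sq_real x₀ y
    rw [hx₀, hy] at h1
    nlinarith [norm_nonneg (x₀ - y)]
  have hA := hMle ((5 / 2 : ℝ) • x₀ + (-3 / 2 : ℝ) • y)
  have hB := hMle ((-3 / 2 : ℝ) • x₀ + (5 / 2 : ℝ) • y)
  rw [map_add, map_smul, map_smul, norm_sq_smul_add_smul, norm_sq_smul_add_smul, hx₀, hy] at hA hB
  have hty := ht y hyN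
  have hM0 : 0 ≤ M := abs_nonneg _
  have hMt : M ≤ 32 * t := by
    have hMi := mul_le_mul_of_nonneg_left hin hM0
    rw [abs_le] at hA hB hty
    rcases abs_cases (‖T x₀‖ ^ 2 - 1) with ⟨h, -⟩ | ⟨h, -⟩ <;> rw [← hM] at h <;> linarith
  exact (hMle x).trans (by gcongr)

end Net

section GramMatrix

variable {α : Type*} [MeasurableSpace α] {P : Measure α} [IsProbabilityMeasure P]
  {E : Type*} [NormedAddCommGroup E] [InnerProductSpace ℝ E] [FiniteDimensional ℝ E]
  [MeasurableSpace E] [BorelSpace E] {h : α → E} {m : ℝ}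

/-- Independent sub-Gaussian unit vectors are almost orthonormal when the dimension is large. -/
theorem measure_not_almost_orthonormal_le (hm : 0 < m) (hh : Measurable h)
    (hnorm : ∀ᵐ p ∂P, ‖h p‖ = 1)
    (hmgf : ∀ a : E, ∫⁻ p, ENNReal.ofReal (Real.exp ⟪a, h p⟫_ℝ) ∂P ≤
      ENNReal.ofReal (Real.exp (‖a‖ ^ 2 / (2 * m)))) {n : ℕ} {t : ℝ} (ht0 : 0 ≤ t) (ht1 : t ≤ 1)
    (hmt : 48 * n ≤ m * t ^ 2) :
    (Measure.pi fun _ => P) {S : Fin n → α | ¬ ∀ c : Fin n → ℝ,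
        |‖∑ i, c i • h (S i)‖ ^ 2 - ∑ i, c i ^ 2| ≤ 32 * t * ∑ i, c i ^ 2} ≤
      ENNReal.ofReal (2 * Real.exp (-(n : ℝ))) := by
  obtain ⟨N, hN, hcard, hnet⟩ := exists_half_net_sphere (EuclideanSpace ℝ (Fin n))
  rw [finrank_euclideanSpace_fin] at hcard
  have hsub : {S : Fin n → α | ¬ ∀ c : Fin n → ℝ,
        |‖∑ i, c i • h (S i)‖ ^ 2 - ∑ i, c i ^ 2| ≤ 32 * t * ∑ i, c i ^ 2} ⊆
      ⋃ y ∈ N, {S : Fin n → α | t ≤ |‖∑ i, y i • h (S i)‖ ^ 2 - 1|} := by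
    intro S hS
    rw [mem_ofPred_eq] at hS
    by_contra hcon
    apply hS
    intro c
    simp only [mem_iUnion, mem_ofPred_eq, not_exists, not_le] at hcon
    have := abs_norm_sq_sub_le_of_half_net
      ((Fintype.linearCombination ℝ fun i => h (S i)).comp
        (WithLp.linearEquiv 2 ℝ (Fin n → ℝ)).toLinearMap) (N := (N : Set _)) hN hnet (t := t)
      (fun y hy => (hcon y hy).le) (WithLp.toLp 2 c)
    simpa [EuclideanSpace.norm_sq_eq, Fintype.linearCombination_apply] using this
  have hexp2 : (5 : ℝ) ≤ Real.exp 2 := by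
    have h1 := Real.exp_one_gt_d9
    have h2 : Real.exp 2 = Real.exp 1 * Real.exp 1 := by rw [← Real.exp_add]; norm_num
    nlinarith
  calc _ ≤ ∑ y ∈ N, (Measure.pi fun _ => P)
          {S : Fin n → α | t ≤ |‖∑ i, y i • h (S i)‖ ^ 2 - 1|} :=
        (measure_mono hsub).trans (measure_biUnion_finset_le _ _)
    _ ≤ ∑ _y ∈ N, ENNReal.ofReal (2 * Real.exp (-(m * t ^ 2 / 16))) := by
        refine Finset.sum_le_sum fun y hy => ?_
        refine measure_norm_sq_sum_deviation_le hm hh hnorm hmgf _ ?_ ht0 ht1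
        have := hN y hy
        have h2 : ‖y‖ ^ 2 = 1 := by rw [this]; norm_num
        simpa [EuclideanSpace.norm_sq_eq] using h2
    _ = ENNReal.ofReal (N.card * (2 * Real.exp (-(m * t ^ 2 / 16)))) := by
        rw [Finset.sum_const, nsmul_eq_mul, ENNReal.ofReal_mul N.card.cast_nonneg,
          ENNReal.ofReal_natCast]
    _ ≤ _ := by
        refine ENNReal.ofReal_le_ofReal ?_
        have h1 : (N.card : ℝ) ≤ Real.exp 2 ^ n := by
          calc (N.card : ℝ) ≤ (5 : ℝ) ^ n := by exact_mod_cast hcard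
            _ ≤ _ := by gcongr
        rw [← Real.exp_nat_mul] at h1
        have h2 : Real.exp (-(m * t ^ 2 / 16)) ≤ Real.exp (-(n * 3)) :=
          Real.exp_le_exp.2 (by linarith)
        calc _ ≤ Real.exp (n * 2) * (2 * Real.exp (-(n * 3))) := by gcongr
          _ = 2 * (Real.exp (n * 2) * Real.exp (-(n * 3))) := by ring
          _ = _ := by rw [← Real.exp_add]; ring_nf

end GramMatrix

/-! ### Near-max-margin solutions on an almost orthonormal sample -/

section Margin

theorem margin_linearModel {d n : ℕ} (w : Feature d) (S : Sample d n) :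
    margin (linearModel w) S = ⨅ i, ⟪w, (S i).2 • (S i).1⟫_ℝ := by
  simp [margin, linearModel, inner_smul_right]

theorem margin_linearModel_le {d n : ℕ} (w : Feature d) (S : Sample d n) (i : Fin n) :
    margin (linearModel w) S ≤ ⟪w, (S i).2 • (S i).1⟫_ℝ := by
  rw [margin_linearModel]
  exact ciInf_le (finite_range _).bddBelow i

theorem bddAbove_margin {d n : ℕ} (hn : 0 < n) (S : Sample d n) :
    BddAbove ((fun w : Feature d => margin (linearModel w) S) '' Metric.closedBall 0 1) := by
  refine ⟨‖(S ⟨0, hn⟩).2 • (S ⟨0, hn⟩).1‖, ?_⟩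
  rintro _ ⟨w, hw, rfl⟩
  have hw : ‖w‖ ≤ 1 := by simpa using hw
  refine (margin_linearModel_le w S ⟨0, hn⟩).trans ((real_inner_le_norm _ _).trans ?_)
  exact mul_le_of_le_one_left (norm_nonneg _) hw

theorem maxMargin_nonneg {d n : ℕ} (S : Sample d n) : 0 ≤ maxMargin S := by
  by_cases hb : BddAbove ((fun w : Feature d => margin (linearModel w) S) '' Metric.closedBall 0 1)
  · refine le_csSup hb ⟨0, by simp, ?_⟩
    simp [margin, linearModel]
  · rw [maxMargin, Real.sSup_of_not_bddAbove hb]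

theorem IsNearMaxMargin.mono {d n : ℕ} {ε ε' : ℝ} {S : Sample d n} {w : Feature d} (hε : ε ≤ ε')
    (h : IsNearMaxMargin ε S w) : IsNearMaxMargin ε' S w :=
  ⟨h.1, le_trans (mul_le_mul_of_nonneg_right (by linarith) (maxMargin_nonneg S)) h.2⟩

/-- Vectors whose Gram matrix is bounded below admit a short vector in their span that has inner
product `1` with all of them. -/
theorem exists_inner_eq_one {E : Type*} [NormedAddCommGroup E] [InnerProductSpace ℝ E] {n : ℕ}
    {u : Fin n → E} {τ : ℝ} (hτ : τ < 1)
    (hu : ∀ c : Fin n → ℝ, (1 - τ) * ∑ i, c i ^ 2 ≤ ‖∑ i, c i • u i‖ ^ 2) :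
    ∃ c : Fin n → ℝ, (∀ i, ⟪∑ j, c j • u j, u i⟫_ℝ = 1) ∧
      (1 - τ) * ‖∑ j, c j • u j‖ ^ 2 ≤ n := by
  let G : (Fin n → ℝ) →ₗ[ℝ] (Fin n → ℝ) :=
    { toFun := fun c i => ⟪∑ j, c j • u j, u i⟫_ℝ
      map_add' := fun c c' => by
        ext i; simp [add_smul, Finset.sum_add_distrib, inner_add_left]
      map_smul' := fun r c => by
        ext i; simp [mul_smul, ← Finset.smul_sum, inner_smul_left] }
  have hnorm : ∀ c : Fin n → ℝ, ‖∑ j, c j • u j‖ ^ 2 = ∑ i, c i * G c i := by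
    intro c
    rw [← real_inner_self_eq_norm_sq]
    conv_lhs => rw [inner_sum]
    simp only [inner_smul_right]
    rfl
  have hinj : Function.Injective G := by
    rw [injective_iff_map_eq_zero]
    intro c hc
    have h1 := hu c
    rw [hnorm, hc] at h1
    simp only [Pi.zero_apply, mul_zero, Finset.sum_const_zero] at h1
    have h2 : ∑ i, c i ^ 2 ≤ 0 := by
      by_contra! h
      nlinarith [mul_pos (sub_pos.2 hτ) h]
    have h3 := (Finset.sum_eq_zero_iff_of_nonneg fun i _ => sq_nonneg (c i)).1
      (le_antisymm h2 (Finset.sum_nonneg fun i _ => sq_nonneg (c i)))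
    ext i
    simpa using h3 i (Finset.mem_univ i)
  obtain ⟨c, hc⟩ := LinearMap.injective_iff_surjective.1 hinj (fun _ => 1)
  refine ⟨c, fun i => congrFun hc i, ?_⟩
  have h1 := hnorm c
  rw [hc] at h1
  simp only [mul_one] at h1
  have h2 := hu c
  have h3 : (∑ i, c i) ^ 2 ≤ n * ∑ i, c i ^ 2 := by
    simpa using sq_sum_le_card_mul_sum_sq (s := Finset.univ) (f := c)
  rw [h1] at h2 ⊢
  have h0 : 0 ≤ ∑ i, c i := h1 ▸ sq_nonneg _
  rcases h0.eq_or_lt with h | h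
  · rw [← h]; simp
  · by_contra! hcon
    have hn : (0 : ℝ) ≤ n := n.cast_nonneg
    nlinarith [mul_le_mul_of_nonneg_left h2 hn, mul_lt_mul_of_pos_right hcon h, sub_pos.2 hτ,
      mul_le_mul_of_nonneg_left h3 (sub_pos.2 hτ).le]

variable {d n : ℕ} {μ : Feature d} {R τ : ℝ} {S : Sample d n} {u : Fin n → Feature d}

/-- Lower bound for the maximum margin, nearly that of an exactly orthonormal sample. -/
theorem sqrt_le_maxMargin (hn : 0 < n) (hμ : ‖μ‖ = 1) (hτ : τ < 1)
    (hS : ∀ i, (S i).2 • (S i).1 = μ + R • u i) (horth : ∀ i, ⟪μ, u i⟫_ℝ = 0)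
    (hu : ∀ c : Fin n → ℝ, (1 - τ) * ∑ i, c i ^ 2 ≤ ‖∑ i, c i • u i‖ ^ 2) :
    √(1 + R ^ 2 * (1 - τ) / n) ≤ maxMargin S := by
  obtain ⟨c, hc1, hc2⟩ := exists_inner_eq_one hτ hu
  set v := ∑ j, c j • u j with hv
  have hn' : (0 : ℝ) < n := by exact_mod_cast hn
  have hμv : ⟪μ, v⟫_ℝ = 0 := by
    simp [hv, inner_sum, inner_smul_right, horth]
  set Q := 1 + R ^ 2 * (1 - τ) / n with hQ
  have hτ' : 0 < 1 - τ := sub_pos.2 hτ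
  have hQ1 : 0 < Q := by positivity
  have hsQ : 0 < √Q := Real.sqrt_pos.2 hQ1
  -- the optimal direction for exactly orthonormal vectors
  set w := μ + (R * (1 - τ) / n) • v with hw
  have hwn : ‖w‖ ^ 2 ≤ Q := by
    rw [hw, norm_add_sq_real, hμ, inner_smul_right, hμv, norm_smul, mul_pow, Real.norm_eq_abs,
      sq_abs, hQ]
    have : (R * (1 - τ) / n) ^ 2 * ‖v‖ ^ 2 = R ^ 2 * (1 - τ) / n ^ 2 * ((1 - τ) * ‖v‖ ^ 2) := by
      ring
    rw [this]
    have h2 : R ^ 2 * (1 - τ) / n ^ 2 * ((1 - τ) * ‖v‖ ^ 2) ≤ R ^ 2 * (1 - τ) / n ^ 2 * n := by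
      gcongr
    have h3 : R ^ 2 * (1 - τ) / (n : ℝ) ^ 2 * n = R ^ 2 * (1 - τ) / n := by field_simp
    linarith
  have hwi : ∀ i, ⟪w, (S i).2 • (S i).1⟫_ℝ = Q := by
    intro i
    rw [hS, hw, inner_add_left, inner_add_right, inner_add_right, inner_smul_left, inner_smul_left,
      inner_smul_right, inner_smul_right, horth, hc1, real_inner_comm μ v, hμv,
      real_inner_self_eq_norm_sq, hμ, hQ]
    simp only [RCLike.conj_to_real]
    ring
  refine le_csSup (bddAbove_margin hn S) ⟨(√Q)⁻¹ • w, ?_, ?_⟩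
  · rw [mem_closedBall_zero_iff, norm_smul, norm_inv, Real.norm_of_nonneg hsQ.le,
      inv_mul_le_iff₀ hsQ, mul_one]
    exact Real.le_sqrt_of_sq_le hwn
  · have : Nonempty (Fin n) := ⟨⟨0, hn⟩⟩
    simp only [margin_linearModel, inner_smul_left, hwi, RCLike.conj_to_real, ciInf_const]
    rw [inv_mul_eq_div, Real.div_sqrt]

/-- The minimum is at most the average, and the average of `⟪w - ⟪μ, w⟫ • μ, u i⟫` is controlled by
the norm of the sum of the vectors `u i`. -/
theorem margin_le_of_almost_orthonormal (hn : 0 < n) (hR : 0 ≤ R)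
    (hS : ∀ i, (S i).2 • (S i).1 = μ + R • u i) (horth : ∀ i, ⟪μ, u i⟫_ℝ = 0)
    (hu : ‖∑ i, u i‖ ^ 2 ≤ (1 + τ) * n) (w : Feature d) :
    margin (linearModel w) S ≤
      ⟪μ, w⟫_ℝ + ‖w - ⟪μ, w⟫_ℝ • μ‖ * √((1 + τ) * R ^ 2 / n) := by
  have hn' : (0 : ℝ) < n := by exact_mod_cast hn
  set v := w - ⟪μ, w⟫_ℝ • μ with hv
  have hwi : ∀ i, ⟪w, (S i).2 • (S i).1⟫_ℝ = ⟪μ, w⟫_ℝ + R * ⟪v, u i⟫_ℝ := by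
    intro i
    rw [hS, inner_add_right, inner_smul_right, hv, inner_sub_left, inner_smul_left, horth,
      real_inner_comm]
    simp
  have h1 : n * margin (linearModel w) S ≤ n * ⟪μ, w⟫_ℝ + R * ⟪v, ∑ i, u i⟫_ℝ := by
    calc n * margin (linearModel w) S = ∑ _i : Fin n, margin (linearModel w) S := by simp
      _ ≤ ∑ i, (⟪μ, w⟫_ℝ + R * ⟪v, u i⟫_ℝ) :=
          Finset.sum_le_sum fun i _ => (margin_linearModel_le w S i).trans_eq (hwi i)
      _ = _ := by simp [Finset.sum_add_distrib, inner_sum, Finset.mul_sum]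
  have h2 : ⟪v, ∑ i, u i⟫_ℝ ≤ ‖v‖ * √((1 + τ) * n) :=
    (real_inner_le_norm _ _).trans (by gcongr; exact Real.le_sqrt_of_sq_le hu)
  have h3 : n * √((1 + τ) * R ^ 2 / n) = R * √((1 + τ) * n) := by
    have e : (1 + τ) * R ^ 2 / n = (R / n) ^ 2 * ((1 + τ) * n) := by field_simp
    rw [e, Real.sqrt_mul (sq_nonneg _), Real.sqrt_sq (by positivity)]
    field_simp
  have h4 := mul_le_mul_of_nonneg_left h2 hR
  refine le_of_mul_le_mul_left ?_ hn'
  calc _ ≤ _ := h1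
    _ ≤ n * ⟪μ, w⟫_ℝ + ‖v‖ * (R * √((1 + τ) * n)) := by linarith
    _ = _ := by rw [← h3]; ring

/-- If the ratio of signal to noise part is `b < 1 / 4` times the optimal one, the margin falls
short of `1 - ε` times the maximum. Without errors (`τ = ε = 0`, `T = 1`) the difference of the two
sides is `k * (1 - b) ^ 2`, which dominates the errors. -/
theorem sq_lt_of_ratio_lt {k τ ε b T : ℝ} (hk : 0 < k) (hτ : 0 ≤ τ) (hε : 0 ≤ ε)
    (h1 : 2 * ε + τ ≤ k / 10) (h2 : (2 * ε + τ) * k ≤ 1 / 10)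
    (hT1 : 1 ≤ T) (hT2 : T ^ 2 = 1 + τ) (hb : b < 1 / 4) :
    (b * k + T) ^ 2 < (1 - ε) ^ 2 * (k + (1 - τ)) * (1 + b ^ 2 * k) := by
  set e := 2 * ε + τ with he
  have he0 : 0 ≤ e := by positivity
  have he1 : e ≤ 1 / 10 := by nlinarith
  have hA1 : e * (k + 1) ≤ k / 5 := by nlinarith
  have hA2 : e * (k + 1) ≤ 1 / 5 := by nlinarith
  have hTτ : T ≤ 1 + τ / 2 := by nlinarith
  have hb2 : 0 ≤ b ^ 2 * k := by positivity
  have hR : (1 - e) * (k + 1) ≤ (1 - ε) ^ 2 * (k + (1 - τ)) := by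
    have hτ1 : τ ≤ 1 / 10 := by linarith
    have hε1 : 0 ≤ 1 - 2 * ε := by linarith
    calc (1 - e) * (k + 1) ≤ (1 - 2 * ε) * (1 - τ) * (k + 1) := by
          gcongr
          nlinarith [mul_nonneg hε hτ]
      _ = (1 - 2 * ε) * ((1 - τ) * (k + 1)) := by ring
      _ ≤ (1 - 2 * ε) * (k + (1 - τ)) := by
          gcongr
          nlinarith
      _ ≤ (1 - ε) ^ 2 * (k + (1 - τ)) := by
          have : 0 ≤ k + (1 - τ) := by linarith
          gcongr
          nlinarith [sq_nonneg ε]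
  have hR' := mul_le_mul_of_nonneg_right hR (show 0 ≤ 1 + b ^ 2 * k by positivity)
  have hA3 := mul_le_mul_of_nonneg_right hA2 hb2
  have hbT : b * k * T ≤ b * k + |b| * k / 20 := by
    have h3 : b * (T - 1) ≤ |b| * (1 / 20) := by
      calc b * (T - 1) ≤ |b| * (T - 1) :=
            mul_le_mul_of_nonneg_right (le_abs_self b) (by linarith)
        _ ≤ _ := by gcongr; linarith
    nlinarith
  have hτk : τ ≤ k / 10 := by linarith
  have hfin : 0 < k * (7 / 10 + 4 / 5 * b ^ 2 - 2 * b - |b| / 10) := by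
    apply mul_pos hk
    rcases abs_cases b with ⟨h, h'⟩ | ⟨h, h'⟩ <;> rw [h] <;> nlinarith [sq_nonneg b]
  nlinarith

/-- Here `a` and `s` are the sizes of the signal and noise parts of a vector. Reaching `1 - ε` times
the maximum margin forces their ratio to be at least a quarter of the optimal ratio `√k`. -/
theorem ratio_of_near_optimal {k τ ε a s : ℝ} (hk : 0 < k) (hτ : 0 ≤ τ) (hε : 0 ≤ ε)
    (h1 : 2 * ε + τ ≤ k / 10) (h2 : (2 * ε + τ) * k ≤ 1 / 10) (hs : 0 < s)
    (h : (1 - ε) * √(1 + (1 - τ) / k) * √(a ^ 2 + s ^ 2) ≤ a + s * √((1 + τ) / k)) :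
    √k * s / 4 ≤ a := by
  by_contra! hcon
  have hK : 0 < √k := Real.sqrt_pos.2 hk
  have hKk : √k ^ 2 = k := Real.sq_sqrt hk.le
  have hlt := sq_lt_of_ratio_lt (b := a / (√k * s)) (T := √(1 + τ)) hk hτ hε h1 h2
    (by rw [Real.one_le_sqrt]; linarith) (Real.sq_sqrt (by linarith))
    (by rw [div_lt_iff₀ (by positivity)]; linarith)
  have hτ1 : τ ≤ 1 := by nlinarith
  have hε1 : ε ≤ 1 := by nlinarith
  have hsq : ((1 - ε) * √(1 + (1 - τ) / k) * √(a ^ 2 + s ^ 2)) ^ 2 ≤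
      (a + s * √((1 + τ) / k)) ^ 2 := by
    refine pow_le_pow_left₀ ?_ h 2
    have : 0 ≤ 1 - ε := by linarith
    positivity
  have hq : 0 ≤ (1 - τ) / k := div_nonneg (by linarith) hk.le
  rw [mul_pow, mul_pow, Real.sq_sqrt (by positivity), Real.sq_sqrt (by positivity),
    Real.sqrt_div (by positivity)] at hsq
  have e1 : (a + s * (√(1 + τ) / √k)) ^ 2 =
      (a / (√k * s) * k + √(1 + τ)) ^ 2 * (s ^ 2 / k) := by
    have : s ^ 2 / k = (s / √k) ^ 2 := by rw [div_pow, hKk]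
    rw [this, ← mul_pow]
    congr 1
    have h3 : a / (√k * s) * k = a * √k / s := by
      rw [div_mul_eq_mul_div, div_eq_div_iff (by positivity) hs.ne']
      linear_combination -(a * s) * hKk
    rw [h3]
    field_simp
  have e2 : (1 - ε) ^ 2 * (1 + (1 - τ) / k) * (a ^ 2 + s ^ 2) =
      (1 - ε) ^ 2 * (k + (1 - τ)) * (1 + (a / (√k * s)) ^ 2 * k) * (s ^ 2 / k) := by
    rw [div_pow, mul_pow, hKk]
    field_simp
    ring
  rw [e1, e2] at hsq
  have := mul_lt_mul_of_pos_right hlt (show 0 < s ^ 2 / k by positivity)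
  linarith

/-- On an almost orthonormal sample, near-max-margin solutions have a signal part comparable to the
optimal one. -/
theorem IsNearMaxMargin.signal_ge {ε : ℝ} {w : Feature d} (hn : 0 < n) (hμ : ‖μ‖ = 1) (hR : 0 < R)
    (hτ : 0 ≤ τ) (hε : 0 ≤ ε) (h1 : 2 * ε + τ ≤ n / R ^ 2 / 10)
    (h2 : (2 * ε + τ) * (n / R ^ 2) ≤ 1 / 10)
    (hS : ∀ i, (S i).2 • (S i).1 = μ + R • u i) (horth : ∀ i, ⟪μ, u i⟫_ℝ = 0)
    (hu : ∀ c : Fin n → ℝ, |‖∑ i, c i • u i‖ ^ 2 - ∑ i, c i ^ 2| ≤ τ * ∑ i, c i ^ 2)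
    (hw : IsNearMaxMargin ε S w) :
    √(n / R ^ 2) * ‖w - ⟪μ, w⟫_ℝ • μ‖ / 4 ≤ ⟪μ, w⟫_ℝ ∧ 0 < ⟪μ, w⟫_ℝ := by
  have hn' : (0 : ℝ) < n := by exact_mod_cast hn
  obtain ⟨hw0, hwm⟩ := hw
  have hk : (0 : ℝ) < n / R ^ 2 := by positivity
  have hτ1 : τ < 1 := by nlinarith
  have hε1 : ε < 1 := by nlinarith
  have hlow : ∀ c : Fin n → ℝ, (1 - τ) * ∑ i, c i ^ 2 ≤ ‖∑ i, c i • u i‖ ^ 2 := by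
    intro c
    have := (abs_le.1 (hu c)).1
    linarith
  have hup : ‖∑ i, u i‖ ^ 2 ≤ (1 + τ) * n := by
    have := (abs_le.1 (hu fun _ => 1)).2
    simp only [one_smul, one_pow, Finset.sum_const, Finset.card_univ, Fintype.card_fin,
      nsmul_eq_mul, mul_one] at this
    linarith
  have hmax := sqrt_le_maxMargin hn hμ hτ1 hS horth hlow
  have hmar := margin_le_of_almost_orthonormal hn hR.le hS horth hup w
  set a := ⟪μ, w⟫_ℝ with ha
  set v := w - a • μ with hv
  have hwn : ‖w‖ = √(a ^ 2 + ‖v‖ ^ 2) := by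
    have hvμ : ⟪v, μ⟫_ℝ = 0 := by
      rw [hv, inner_sub_left, inner_smul_left, real_inner_self_eq_norm_sq, hμ, real_inner_comm μ w,
        ← ha]
      simp
    rw [eq_comm, Real.sqrt_eq_iff_mul_self_eq (by positivity) (norm_nonneg _), ← sq,
      show w = v + a • μ by rw [hv]; abel, norm_add_sq_real, inner_smul_right, hvμ, norm_smul, hμ,
      mul_one, mul_zero, mul_zero, Real.norm_eq_abs, sq_abs]
    ring
  have hwpos : 0 < ‖w‖ := norm_pos_iff.2 hw0
  rw [le_div_iff₀ hwpos] at hwm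
  have hmain : (1 - ε) * √(1 + (1 - τ) / (n / R ^ 2)) * √(a ^ 2 + ‖v‖ ^ 2) ≤
      a + ‖v‖ * √((1 + τ) / (n / R ^ 2)) := by
    have e1 : (1 - τ) / (n / R ^ 2) = R ^ 2 * (1 - τ) / n := by field_simp
    have e2 : (1 + τ) / (n / R ^ 2) = (1 + τ) * R ^ 2 / n := by field_simp
    rw [e1, e2, ← hwn]
    refine le_trans ?_ (hwm.trans hmar)
    have : 0 ≤ 1 - ε := by linarith
    gcongr
  -- without a noise part, only the sign of `a` is at stake
  rcases (norm_nonneg v).eq_or_lt with hv0 | hv0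
  · rw [← hv0] at hmain hwn ⊢
    rw [← hwn, zero_mul, add_zero] at hmain
    have hq : 0 ≤ (1 - τ) / (n / R ^ 2) := div_nonneg (by linarith) hk.le
    have : 0 < (1 - ε) * √(1 + (1 - τ) / (n / R ^ 2)) * ‖w‖ := by
      have : 0 < 1 - ε := by linarith
      positivity
    constructor <;> linarith
  · have := ratio_of_near_optimal hk hτ hε h1 h2 hv0 hmain
    exact ⟨this, lt_of_lt_of_le (by positivity) this⟩

end Margin

/-! ### The data distribution -/

section Distribution

/-- The normalized noise of an example: under the data distribution with signal direction `μ` and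
noise radius `R`, the vector `y • x` equals `μ + R • h` with `h` the value of this function. -/
noncomputable def normalizedNoise {d : ℕ} (μ : Feature d) (R : ℝ) (p : Example d) : Feature d :=
  R⁻¹ • (p.2 • p.1 - μ)

variable {d : ℕ} {μ : Feature d} {σ R : ℝ}

@[fun_prop]
theorem measurable_normalizedNoise : Measurable (normalizedNoise μ R) := by
  unfold normalizedNoise
  fun_prop

theorem smul_eq_add_normalizedNoise (hR : R ≠ 0) (p : Example d) :
    p.2 • p.1 = μ + R • normalizedNoise μ R p := by
  rw [normalizedNoise, smul_inv_smul₀ hR]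
  abel

theorem finrank_orthogonal_singleton (hμ : ‖μ‖ = 1) :
    Module.finrank ℝ (ℝ ∙ μ)ᗮ = d - 1 := by
  have h := (ℝ ∙ μ).finrank_add_finrank_orthogonal
  rw [finrank_span_singleton (by rw [← norm_ne_zero_iff, hμ]; exact one_ne_zero),
    finrank_euclideanSpace_fin] at h
  omega

theorem nontrivial_orthogonal_singleton (hd : 2 ≤ d) (hμ : ‖μ‖ = 1) : Nontrivial (ℝ ∙ μ)ᗮ := by
  apply Module.nontrivial_of_finrank_pos (R := ℝ)
  rw [finrank_orthogonal_singleton hμ]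
  omega

theorem inner_coe_orthogonal_singleton (u : (ℝ ∙ μ)ᗮ) : ⟪μ, (u : Feature d)⟫_ℝ = 0 :=
  Submodule.mem_orthogonal_singleton_iff_inner_right.1 u.2

/-- The data distribution as a mixture of its two label classes. -/
theorem lintegral_linearDist (hd : 2 ≤ d) (hμ : ‖μ‖ = 1) (hR : R = √((d : ℝ) - 1) * σ)
    {F : Example d → ℝ≥0∞} (hF : Measurable F) :
    ∫⁻ p, F p ∂(linearDist μ σ) =
      2⁻¹ * (∫⁻ u, F (μ + R • ((u : (ℝ ∙ μ)ᗮ) : Feature d), 1) ∂(uniformUnitSphere (ℝ ∙ μ)ᗮ) +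
        ∫⁻ u, F (-μ + R • ((u : (ℝ ∙ μ)ᗮ) : Feature d), -1)
          ∂(uniformUnitSphere (ℝ ∙ μ)ᗮ)) := by
  have := nontrivial_orthogonal_singleton hd hμ
  have hm : Measurable fun u : Metric.sphere (0 : (ℝ ∙ μ)ᗮ) 1 =>
      (√((d : ℝ) - 1) * σ) • ((u : (ℝ ∙ μ)ᗮ) : Feature d) := by fun_prop
  have hprob : IsProbabilityMeasure (noiseLaw μ σ) :=
    Measure.isProbabilityMeasure_map hm.aemeasurable
  have hadd : Measurable fun p : Feature d × Feature d => (p.1 + p.2, ⟪μ, p.1 + p.2⟫_ℝ) := by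
    fun_prop
  have hz : ∀ z : Feature d, ∫⁻ ξ, F (z + ξ, ⟪μ, z + ξ⟫_ℝ) ∂(noiseLaw μ σ) =
      ∫⁻ u, F (z + R • ((u : (ℝ ∙ μ)ᗮ) : Feature d), ⟪μ, z⟫_ℝ)
        ∂(uniformUnitSphere (ℝ ∙ μ)ᗮ) := by
    intro z
    have hFz : Measurable fun ξ : Feature d => F (z + ξ, ⟪μ, z + ξ⟫_ℝ) := hF.comp (by fun_prop)
    rw [noiseLaw, lintegral_map hFz hm]
    simp only [inner_add_right, inner_smul_right, inner_coe_orthogonal_singleton, mul_zero,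
      add_zero, hR]
  have hG : Measurable fun p : Feature d × Feature d => F (p.1 + p.2, ⟪μ, p.1 + p.2⟫_ℝ) :=
    hF.comp hadd
  rw [linearDist, lintegral_map hF hadd, lintegral_prod _ hG.aemeasurable, signalLaw,
    lintegral_smul_measure, lintegral_add_measure, lintegral_dirac, lintegral_dirac, hz, hz,
    inner_neg_right, real_inner_self_eq_norm_sq, hμ, smul_eq_mul]
  norm_num

theorem isProbabilityMeasure_linearDist (hd : 2 ≤ d) (hμ : ‖μ‖ = 1) :
    IsProbabilityMeasure (linearDist μ σ) := by
  have := nontrivial_orthogonal_singleton hd hμ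
  refine ⟨?_⟩
  rw [← lintegral_one, lintegral_linearDist hd hμ rfl measurable_const]
  simp only [lintegral_one, measure_univ]
  rw [one_add_one_eq_two, ENNReal.inv_mul_cancel two_ne_zero ENNReal.ofNat_ne_top]

theorem normalizedNoise_pos (hR : R ≠ 0) (u : Feature d) :
    normalizedNoise μ R (μ + R • u, 1) = u := by
  simp [normalizedNoise, inv_smul_smul₀ hR]

theorem normalizedNoise_neg (hR : R ≠ 0) (u : Feature d) :
    normalizedNoise μ R (-μ + R • u, -1) = -u := by
  simp [normalizedNoise, inv_smul_smul₀ hR]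

theorem ae_linearDist (hd : 2 ≤ d) (hμ : ‖μ‖ = 1) (hR : R = √((d : ℝ) - 1) * σ) (hR0 : R ≠ 0) :
    ∀ᵐ p ∂(linearDist μ σ), ‖normalizedNoise μ R p‖ = 1 ∧ ⟪μ, normalizedNoise μ R p⟫_ℝ = 0 ∧
      (p.2 = 1 ∨ p.2 = -1) := by
  have hs : MeasurableSet {p : Example d | ‖normalizedNoise μ R p‖ = 1 ∧
      ⟪μ, normalizedNoise μ R p⟫_ℝ = 0 ∧ (p.2 = 1 ∨ p.2 = -1)} := by
    refine MeasurableSet.inter ?_ (MeasurableSet.inter ?_ (MeasurableSet.union ?_ ?_))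
    all_goals exact measurableSet_eq_fun (by fun_prop) (by fun_prop)
  have hn : ∀ u : Metric.sphere (0 : (ℝ ∙ μ)ᗮ) 1, ‖((u : (ℝ ∙ μ)ᗮ) : Feature d)‖ = 1 :=
    fun u => norm_eq_of_mem_sphere u
  rw [ae_iff, ← lintegral_indicator_one (by exact hs.compl), lintegral_linearDist hd hμ hR
    (measurable_one.indicator (by exact hs.compl))]
  simp [indicator, normalizedNoise_pos hR0, normalizedNoise_neg hR0,
    inner_coe_orthogonal_singleton, hn]

theorem lintegral_exp_inner_normalizedNoise_le (hd : 2 ≤ d) (hμ : ‖μ‖ = 1)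
    (hR : R = √((d : ℝ) - 1) * σ) (hR0 : R ≠ 0) (a : Feature d) :
    ∫⁻ p, ENNReal.ofReal (Real.exp ⟪a, normalizedNoise μ R p⟫_ℝ) ∂(linearDist μ σ) ≤
      ENNReal.ofReal (Real.exp (‖a‖ ^ 2 / (2 * ((d : ℝ) - 1)))) := by
  have := nontrivial_orthogonal_singleton hd hμ
  have hd' : (2 : ℝ) ≤ d := by exact_mod_cast hd
  have key : ∀ b : Feature d, ‖b‖ = ‖a‖ → ∫⁻ u, ENNReal.ofReal (Real.exp
      ⟪b, ((u : (ℝ ∙ μ)ᗮ) : Feature d)⟫_ℝ) ∂(uniformUnitSphere (ℝ ∙ μ)ᗮ) ≤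
        ENNReal.ofReal (Real.exp (‖a‖ ^ 2 / (2 * ((d : ℝ) - 1)))) := by
    intro b hb
    have h := lintegral_exp_inner_uniformUnitSphere_le ((ℝ ∙ μ)ᗮ.orthogonalProjectionOnto b)
    rw [finrank_orthogonal_singleton hμ, Nat.cast_sub (by omega), Nat.cast_one] at h
    simp only [Submodule.inner_orthogonalProjectionOnto_eq_of_mem_right] at h
    refine h.trans (ENNReal.ofReal_le_ofReal (Real.exp_le_exp.2 ?_))
    have hle : ‖(ℝ ∙ μ)ᗮ.orthogonalProjectionOnto b‖ ≤ ‖a‖ :=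
      hb ▸ Submodule.norm_orthogonalProjectionOnto_apply_le _ b
    have : 0 ≤ (d : ℝ) - 1 := by linarith
    gcongr
  rw [lintegral_linearDist hd hμ hR (by fun_prop)]
  simp only [normalizedNoise_pos hR0, normalizedNoise_neg hR0, inner_neg_right]
  simp only [← inner_neg_left]
  refine (mul_le_mul_right (add_le_add (key a rfl) (key (-a) (norm_neg a))) _).trans_eq ?_
  rw [← two_mul, ← mul_assoc, ENNReal.inv_mul_cancel two_ne_zero ENNReal.ofNat_ne_top, one_mul]

theorem zeroOneLoss_nonneg (a b : ℝ) : 0 ≤ zeroOneLoss a b := by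
  unfold zeroOneLoss
  split_ifs <;> norm_num

theorem zeroOneLoss_le_exp {x y θ : ℝ} (hθ : 0 ≤ θ) (hy : y = 1 ∨ y = -1) :
    zeroOneLoss x y ≤ Real.exp (-θ * (y * x)) := by
  unfold zeroOneLoss
  split_ifs with h
  · apply Real.one_le_exp
    have hyx : y * x ≤ 0 := by
      by_contra! hpos
      apply h
      rcases hy with rfl | rfl
      · rw [sign_pos (by linarith), sign_pos one_pos]
      · rw [sign_neg (by linarith), sign_neg (by norm_num)]
    nlinarith
  · positivity

/-- Chernoff bound for the test loss, in terms of the signal part `⟪μ, w⟫` and the noise part of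
`w`. -/
theorem testLoss_linearModel_le (hd : 2 ≤ d) (hμ : ‖μ‖ = 1) (hσ : 0 < σ) (w : Feature d) {θ : ℝ}
    (hθ : 0 ≤ θ) :
    testLoss (linearDist μ σ) (linearModel w) ≤
      Real.exp (-θ * ⟪μ, w⟫_ℝ + θ ^ 2 * σ ^ 2 * ‖w - ⟪μ, w⟫_ℝ • μ‖ ^ 2 / 2) := by
  have := isProbabilityMeasure_linearDist (σ := σ) hd hμ
  have hd' : (2 : ℝ) ≤ d := by exact_mod_cast hd
  have hd1 : 0 < (d : ℝ) - 1 := by linarith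
  set R := √((d : ℝ) - 1) * σ with hR
  have hR0 : R ≠ 0 := (mul_pos (Real.sqrt_pos.2 hd1) hσ).ne'
  have hR2 : R ^ 2 = ((d : ℝ) - 1) * σ ^ 2 := by rw [hR, mul_pow, Real.sq_sqrt hd1.le]
  have hae := ae_linearDist hd hμ hR hR0
  set a := ⟪μ, w⟫_ℝ with ha
  set v := w - a • μ with hv
  have hlin : ∫⁻ p, ENNReal.ofReal (Real.exp (-θ * (p.2 * ⟪w, p.1⟫_ℝ))) ∂(linearDist μ σ) ≤
      ENNReal.ofReal (Real.exp (-θ * a + θ ^ 2 * σ ^ 2 * ‖v‖ ^ 2 / 2)) := by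
    have e : ∀ᵐ p ∂(linearDist μ σ), ENNReal.ofReal (Real.exp (-θ * (p.2 * ⟪w, p.1⟫_ℝ))) =
        ENNReal.ofReal (Real.exp (-θ * a)) *
          ENNReal.ofReal (Real.exp ⟪(-θ * R) • v, normalizedNoise μ R p⟫_ℝ) := by
      filter_upwards [hae] with p hp
      rw [← ENNReal.ofReal_mul (by positivity), ← Real.exp_add, ← inner_smul_right,
        smul_eq_add_normalizedNoise (μ := μ) hR0, inner_add_right, inner_smul_right,
        inner_smul_left, hv, inner_sub_left, inner_smul_left, hp.2.1, real_inner_comm μ w, ← ha]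
      simp only [RCLike.conj_to_real]
      ring_nf
    rw [lintegral_congr_ae e, lintegral_const_mul _ (by fun_prop)]
    refine (mul_le_mul_right (lintegral_exp_inner_normalizedNoise_le hd hμ hR hR0 _) _).trans_eq ?_
    rw [← ENNReal.ofReal_mul (by positivity), ← Real.exp_add, norm_smul, mul_pow, Real.norm_eq_abs,
      sq_abs, mul_pow, hR2]
    congr 3
    field_simp
  have hmeas : AEStronglyMeasurable (fun p : Example d => Real.exp (-θ * (p.2 * ⟪w, p.1⟫_ℝ)))
      (linearDist μ σ) := by fun_prop
  have hint : Integrable (fun p : Example d => Real.exp (-θ * (p.2 * ⟪w, p.1⟫_ℝ)))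
      (linearDist μ σ) := by
    refine ⟨hmeas, ?_⟩
    rw [hasFiniteIntegral_iff_ofReal (Filter.Eventually.of_forall fun p => (Real.exp_pos _).le)]
    exact hlin.trans_lt ENNReal.ofReal_lt_top
  calc testLoss (linearDist μ σ) (linearModel w)
      ≤ ∫ p, Real.exp (-θ * (p.2 * ⟪w, p.1⟫_ℝ)) ∂(linearDist μ σ) := by
        refine integral_mono_of_nonneg
          (Filter.Eventually.of_forall fun p => zeroOneLoss_nonneg _ _) hint ?_
        filter_upwards [hae] with p hp
        exact zeroOneLoss_le_exp hθ hp.2.2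
    _ ≤ _ := by
        rw [integral_eq_lintegral_of_nonneg_ae
          (Filter.Eventually.of_forall fun p => (Real.exp_pos _).le) hmeas]
        exact ENNReal.toReal_le_of_le_ofReal (Real.exp_pos _).le hlin

/-- When the signal part of `w` has its optimal order of magnitude, the Chernoff bound at
`θ = 2 * A / ⟪μ, w⟫`, where `A = n / (36 * d * σ ^ 4)` is the target exponent, suffices. -/
theorem testLoss_linearModel_le_of_signal_ge {n : ℕ} (hd : 2 ≤ d) (hμ : ‖μ‖ = 1) (hσ : 0 < σ)
    (w : Feature d) (hpos : 0 < ⟪μ, w⟫_ℝ)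
    (hsig : √(n / (((d : ℝ) - 1) * σ ^ 2)) * ‖w - ⟪μ, w⟫_ℝ • μ‖ / 4 ≤ ⟪μ, w⟫_ℝ) :
    testLoss (linearDist μ σ) (linearModel w) ≤ Real.exp (-((n : ℝ) / (36 * (d : ℝ) * σ ^ 4))) := by
  have hd' : (2 : ℝ) ≤ d := by exact_mod_cast hd
  have hd1 : 0 < (d : ℝ) - 1 := by linarith
  set a := ⟪μ, w⟫_ℝ with ha
  set s := ‖w - a • μ‖ with hs
  set A := (n : ℝ) / (36 * (d : ℝ) * σ ^ 4) with hA
  have hA0 : 0 ≤ A := by positivity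
  refine (testLoss_linearModel_le hd hμ hσ w (θ := 2 * A / a) (by positivity)).trans
    (Real.exp_le_exp.2 ?_)
  have hsq : n / (((d : ℝ) - 1) * σ ^ 2) * s ^ 2 / 16 ≤ a ^ 2 := by
    have := pow_le_pow_left₀ (by positivity) hsig 2
    rw [div_pow, mul_pow, Real.sq_sqrt (by positivity)] at this
    norm_num at this
    exact this
  have hle : 2 * σ ^ 2 * s ^ 2 * A ≤ a ^ 2 := by
    refine le_trans ?_ hsq
    have e : 2 * σ ^ 2 * s ^ 2 * A = n / (18 * d * σ ^ 2) * s ^ 2 := by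
      rw [hA]; field_simp; ring
    have e' : n / (((d : ℝ) - 1) * σ ^ 2) * s ^ 2 / 16 =
        n / (16 * ((d : ℝ) - 1) * σ ^ 2) * s ^ 2 := by field_simp
    rw [e, e']
    gcongr ?_ * _
    refine div_le_div_of_nonneg_left (by positivity) (by positivity) ?_
    gcongr ?_ * _
    linarith
  rw [← ha, ← hs]
  have e1 : -(2 * A / a) * a = -2 * A := by field_simp
  have e2 : (2 * A / a) ^ 2 * σ ^ 2 * s ^ 2 / 2 = A * (2 * σ ^ 2 * s ^ 2 * A / a ^ 2) := by
    field_simp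
  have h3 : 2 * σ ^ 2 * s ^ 2 * A / a ^ 2 ≤ 1 := (div_le_one (by positivity)).2 hle
  rw [e1, e2]
  nlinarith [mul_le_mul_of_nonneg_left h3 hA0]

end Distribution

/-! ### Generalization of near-max-margin solutions -/

/-- The parameter `t` is the deviation allowed on the net, so that the Gram matrix of the noise is
known up to a relative error `32 * t`. -/
theorem nearMaxMarginGeneralizes_of_le {n d : ℕ} {σ ε t : ℝ} {μ : Feature d} (hn : 0 < n)
    (hd : 2 ≤ d) (hμ : ‖μ‖ = 1) (hσ : 0 < σ) (ht : 0 ≤ t) (hε : 0 ≤ ε)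
    (h1 : 2 * ε + 32 * t ≤ n / (((d : ℝ) - 1) * σ ^ 2) / 10)
    (h2 : (2 * ε + 32 * t) * (n / (((d : ℝ) - 1) * σ ^ 2)) ≤ 1 / 10)
    (hdt : 48 * n ≤ ((d : ℝ) - 1) * t ^ 2) :
    NearMaxMarginGeneralizes n d σ ε (linearDist μ σ) := by
  have := isProbabilityMeasure_linearDist (σ := σ) hd hμ
  have hd' : (2 : ℝ) ≤ d := by exact_mod_cast hd
  have hd1 : 0 < (d : ℝ) - 1 := by linarith
  set R := √((d : ℝ) - 1) * σ with hR
  have hR0 : 0 < R := mul_pos (Real.sqrt_pos.2 hd1) hσ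
  have hR2 : R ^ 2 = ((d : ℝ) - 1) * σ ^ 2 := by rw [hR, mul_pow, Real.sq_sqrt hd1.le]
  have hae := ae_linearDist hd hμ hR hR0.ne'
  have hpi : ∀ᵐ S ∂(sampleLaw (linearDist μ σ) n), ∀ i, ⟪μ, normalizedNoise μ R (S i)⟫_ℝ = 0 := by
    rw [ae_all_iff]
    intro i
    have := (measurePreserving_eval (fun _ : Fin n => linearDist μ σ) i).quasiMeasurePreserving.ae
      hae
    filter_upwards [this] with S hS using hS.2.1
  have ht1 : t ≤ 1 := by
    have hk : (0 : ℝ) < n / (((d : ℝ) - 1) * σ ^ 2) := by positivity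
    nlinarith
  have hgram := measure_not_almost_orthonormal_le hd1
    (measurable_normalizedNoise (μ := μ) (R := R)) (hae.mono fun p hp => hp.1)
    (lintegral_exp_inner_normalizedNoise_le hd hμ hR hR0.ne') ht ht1 hdt
  refine (measure_mono_ae ?_).trans (hgram.trans (ENNReal.ofReal_le_ofReal ?_))
  · filter_upwards [hpi] with S hS hbad
    change ¬ _ at hbad
    change ¬ _
    intro hu
    apply hbad
    intro w hw
    obtain ⟨hsig, hpos⟩ := IsNearMaxMargin.signal_ge hn hμ hR0 (τ := 32 * t) (by positivity) hε
      (by rw [hR2]; exact h1) (by rw [hR2]; exact h2)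
      (fun i => smul_eq_add_normalizedNoise hR0.ne' (S i)) hS hu hw
    rw [hR2] at hsig
    refine (testLoss_linearModel_le_of_signal_ge hd hμ hσ w hpos hsig).trans ?_
    linarith [Real.exp_pos (-((n : ℝ) / 8))]
  · linarith [Real.exp_pos (-(n : ℝ))]

theorem NearMaxMarginGeneralizes.anti {n d : ℕ} {σ ε ε' : ℝ} {D : Measure (Example d)}
    (hε : ε ≤ ε') (h : NearMaxMarginGeneralizes n d σ ε' D) :
    NearMaxMarginGeneralizes n d σ ε D :=
  (measure_mono fun _ hS => mt (fun hgood w hw => hgood w (hw.mono hε)) hS).trans h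

/-- Generalization with explicit dependence on the signal-to-noise parameter `κ`. With
`r = min (1 / κ) κ`, the tolerance on the Gram matrix is `32 * t = r / 40`, and the constant
`2 * 10 ^ 8` exceeds `48 * 2 * 1280 ^ 2`, which the concentration bound needs at `t = r / 1280`. -/
theorem nearMaxMarginGeneralizes_of_snr {n d : ℕ} {σ : ℝ} (hσ : 0 < σ)
    {D : Measure (Example d)} (hD : D ∈ linearClass σ d) (hκ : 0 < snr n d σ)
    (hdn : 2 * 10 ^ 8 * max (1 / snr n d σ ^ 2) (snr n d σ ^ 2) ≤ (d : ℝ) / (n : ℝ)) :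
    NearMaxMarginGeneralizes n d σ
      (1 / (2 * 10 ^ 8) * min (1 / snr n d σ) (snr n d σ)) D := by
  obtain ⟨μ, hμ, rfl⟩ := hD
  have hn : 0 < n := by
    rcases Nat.eq_zero_or_pos n with rfl | h
    · simp [snr] at hκ
    · exact h
  have hn' : (0 : ℝ) < n := by exact_mod_cast hn
  have hn1 : (1 : ℝ) ≤ n := by exact_mod_cast hn
  set κ := snr n d σ with hκdef
  set M := max (1 / κ ^ 2) (κ ^ 2) with hM
  set r := min (1 / κ) κ with hr
  have hr0 : 0 < r := lt_min (by positivity) hκ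
  have hrκ : r * κ ≤ 1 := by
    calc r * κ ≤ 1 / κ * κ := by gcongr; exact min_le_left _ _
      _ = 1 := by field_simp
  have hr1 : r ≤ 1 := by nlinarith [min_le_right (1 / κ) κ]
  have hMr : M * r ^ 2 = 1 := by
    rcases le_total κ 1 with h | h
    · have h' : κ ≤ 1 / κ := by rw [le_div_iff₀ hκ]; nlinarith
      have h'' : κ ^ 2 ≤ 1 / κ ^ 2 := by
        rw [← one_div_pow]; exact pow_le_pow_left₀ hκ.le h' 2
      rw [hM, hr, min_eq_right h', max_eq_left h'']
      field_simp
    · have h' : 1 / κ ≤ κ := by rw [div_le_iff₀ hκ]; nlinarith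
      have h'' : 1 / κ ^ 2 ≤ κ ^ 2 := by
        rw [← one_div_pow]; exact pow_le_pow_left₀ (by positivity) h' 2
      rw [hM, hr, min_eq_left h', max_eq_right h'']
      field_simp
  have hdr : 2 * 10 ^ 8 * n ≤ d * r ^ 2 := by
    rw [le_div_iff₀ hn'] at hdn
    have := mul_le_mul_of_nonneg_right hdn (sq_nonneg r)
    calc 2 * 10 ^ 8 * (n : ℝ) = 2 * 10 ^ 8 * (M * r ^ 2) * n := by rw [hMr]; ring
      _ ≤ _ := by linarith
  have hdd : (2 : ℝ) ≤ d := by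
    have : (d : ℝ) * r ^ 2 ≤ d * 1 := by
      gcongr
      exact pow_le_one₀ hr0.le hr1
    linarith
  have hd : 2 ≤ d := by exact_mod_cast hdd
  have hd1 : 0 < (d : ℝ) - 1 := by linarith
  have hk1 : κ ≤ n / (((d : ℝ) - 1) * σ ^ 2) := by
    rw [hκdef, snr]
    gcongr
    linarith
  have hk2 : n / (((d : ℝ) - 1) * σ ^ 2) ≤ 2 * κ := by
    have e : 2 * κ = n / (d / 2 * σ ^ 2) := by rw [hκdef, snr]; field_simp
    rw [e]
    gcongr
    linarith
  have hεt : 2 * (1 / (2 * 10 ^ 8) * r) + 32 * (r / 1280) ≤ r / 20 := by linarith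
  refine nearMaxMarginGeneralizes_of_le hn hd hμ hσ (t := r / 1280) (by positivity)
    (by positivity) ?_ ?_ ?_
  · have := min_le_right (1 / κ) κ
    linarith
  · calc _ ≤ r / 20 * (2 * κ) := by gcongr
      _ ≤ _ := by linarith
  · have : (d : ℝ) / 2 * r ^ 2 ≤ (d - 1) * r ^ 2 := by
      gcongr
      linarith
    linarith

end ExtremalMargin

theorem theorem1 :
    -- constants depending on `δ` only
    (∀ δ : ℝ, 0 < δ → ∃ ε : ℝ, 0 < ε ∧ ∃ c : ℝ, 0 < c ∧
      ∀ (n d : ℕ) (σ : ℝ), 0 < σ →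
        ∀ D ∈ ExtremalMargin.linearClass σ d,
          δ ≤ ExtremalMargin.snr n d σ → ExtremalMargin.snr n d σ ≤ 1 / δ →
          c ≤ (d : ℝ) / (n : ℝ) →
          ExtremalMargin.NearMaxMarginGeneralizes n d σ ε D) ∧
    -- explicit dependence on `κ`, with a universal constant
    (∃ c : ℝ, 0 < c ∧
      ∀ (n d : ℕ) (σ : ℝ), 0 < σ →
        ∀ D ∈ ExtremalMargin.linearClass σ d,
          0 < ExtremalMargin.snr n d σ →
          c * max (1 / ExtremalMargin.snr n d σ ^ 2) (ExtremalMargin.snr n d σ ^ 2)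
            ≤ (d : ℝ) / (n : ℝ) →
          ExtremalMargin.NearMaxMarginGeneralizes n d σ
            (1 / c * min (1 / ExtremalMargin.snr n d σ) (ExtremalMargin.snr n d σ)) D) := by
  refine ⟨fun δ hδ => ⟨1 / (2 * 10 ^ 8) * δ, by positivity, 2 * 10 ^ 8 * (1 / δ ^ 2),
    by positivity, ?_⟩, 2 * 10 ^ 8, by norm_num, ?_⟩
  · intro n d σ hσ D hD hκ1 hκ2 hdn
    have hκ : 0 < ExtremalMargin.snr n d σ := hδ.trans_le hκ1
    have hκ3 : δ ≤ 1 / ExtremalMargin.snr n d σ := by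
      rw [le_div_iff₀ hδ] at hκ2
      rw [le_div_iff₀ hκ]
      linarith
    refine (ExtremalMargin.nearMaxMarginGeneralizes_of_snr hσ hD hκ (le_trans ?_ hdn)).anti ?_
    · gcongr
      refine max_le (by gcongr) ?_
      rw [← one_div_pow]
      gcongr
    · gcongr
      exact le_min hκ3 hκ1
  · intro n d σ hσ D hD hκ hdn
    exact ExtremalMargin.nearMaxMarginGeneralizes_of_snr hσ hD hκ hdn
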